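/- **Theorem (signal recovery for the low-rank tensor single index model).** Let $d\ge 2$, $n\ge 1$ be integers. For a tensor $Z\in\mathbb R^{d\times d\times d\times d}$ let $\mathrm{Mat}(Z)\in\mathbb R^{d^2\times d^2}$ be its square unfolding, $[\mathrm{Mat}(Z)]_{k_1,k_2}=Z(j_1,j_2,j_3,j_4)$ with $k_1=1+(j_1-1)+(j_2-1)d$ and $k_2=1+(j_3-1)+(j_4-1)d$; let $\langle\cdot,\cdot\rangle$ be the entrywise inner product of tensors or matrices, $\|\cdot\|_{\rm fro}$ the associated norm, $\|\cdot\|_\star$ the nuclear norm, and $\mathrm{rank}_{CP}(Z)$ the least $r$ such that $Z$ is a sum of $r$ tensors $u\otimes v\otimes s\otimes t$. *Model.* $Y=f(\langle X,\beta^*\rangle)+\epsilon$, where $\beta^*\in\mathbb R^{d\times d\times d\times d}$ satisfies $\|\beta^*\|_{\rm fro}=1$ and $\mathrm{rank}_{CP}(\beta^*)=r^*$; the entries of the random tensor $X$ are i.i.d. with a differentiable probability density $p_0$ on $\mathbb R$; the noise $\epsilon$ is integrable, independent of $X$, and $\mathbb E\,\epsilon=0$; $f:\mathbb R\to\mathbb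 R$ is differentiable, and $\mu:=\mathbb E[f'(\langle X,\beta^*\rangle)]$ exists and is nonzero. Let $s_0=-p_0'/p_0$, and let $S(X)$ be the tensor obtained by applying $s_0$ to every entry of $X$. Assume that, for some $M>0$, $\mathbb E(Y^4)\le M$ and $\int s_0(u)^4p_0(u)\,du\le M$. Let $(X_i,Y_i)$, $i=1,\dots,n$, be i.i.d. copies of $(X,Y)$. *Estimator.* Let $\phi:\mathbb R\to\mathbb R$ be non-decreasing with $-\log(1-x+x^2/2)\le\phi(x)\le\log(1+x+x^2/2)$ for all $x$. For a matrix $A$ let $\begin{bmatrix}0&A\\A^\top&0\end{bmatrix}=\Upsilon\Lambda\Upsilon^\top$ be an eigendecomposition and let $\psi(A)$ be the upper right block of $\Upsilon\,\phi(\Lambda)\,\Upsilon^\top$, with $\phi$ applied to the diagonal entries of $\Lambda$. Put $$\kappa=\frac{2\sqrt{2\log d}}{\sqrt{(2d^2)\,M\,n}},\qquad \mathcal T_i=\frac1\kappa\,\psi\bigl(\kappa\,Y_i\,\mathrm{Mat}(S(X_i))\bigr),\qquad \lambda=C\sqrt{2M\cdot(2d^2)\cdot\log d/n},$$ and let $\hat\beta$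 be a minimizer over $B\in\mathbb R^{d^2\times d^2}$ of $$\langle B,B\rangle-\frac2n\sum_{i=1}^n\langle\mathcal T_i,B\rangle+\lambda\|B\|_\star .$$ *Conclusion.* There is an absolute constant $C>0$ such that in every such setting, with probability at least $1-(2d^2)^{-2}$, $$\|\hat\beta-\mu\,\mathrm{Mat}(\beta^*)\|_{\rm fro}\le 3\sqrt{r^*}\,\lambda .$$ -/

import Mathlib

open MeasureTheory ProbabilityTheory

namespace TensorSIM

/-! ### Matrices -/

/-- The trace inner product `⟨A, B⟩ = trace (Aᵀ B)`. -/
noncomputable def matInner {m n : Type*} [Fintype m] [Fintype n] (A B : Matrix m n ℝ) : ℝ :=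
  Matrix.trace (A.transpose * B)

/-- The Frobenius norm of a matrix. -/
noncomputable def frobNorm {m n : Type*} [Fintype m] [Fintype n] (A : Matrix m n ℝ) : ℝ :=
  Real.sqrt (∑ i, ∑ j, A i j ^ 2)

/-- The nuclear norm: the sum of the singular values of `A`, i.e. of the square roots of the
eigenvalues (with multiplicity) of `Aᵀ A`. -/
noncomputable def nuclearNorm {m n : Type*} [Fintype m] [Fintype n] [DecidableEq n]
    (A : Matrix m n ℝ) : ℝ :=
  ∑ i, Real.sqrt ((Matrix.isHermitian_conjTranspose_mul_self A).eigenvalues i)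

/-- The symmetric dilation `[[0, A], [Aᵀ, 0]]`. -/
def dilation {m n : Type*} (A : Matrix m n ℝ) : Matrix (m ⊕ n) (m ⊕ n) ℝ :=
  Matrix.fromBlocks 0 A A.transpose 0

theorem dilation_isHermitian {m n : Type*} (A : Matrix m n ℝ) : (dilation A).IsHermitian := by
  rw [dilation, Matrix.isHermitian_fromBlocks_iff]
  exact ⟨Matrix.isHermitian_zero, Matrix.conjTranspose_eq_transpose_of_trivial A, by
    rw [Matrix.conjTranspose_eq_transpose_of_trivial, Matrix.transpose_transpose],
    Matrix.isHermitian_zero⟩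

/-- The influence functions used for the spectral truncation: `φ` is non-decreasing and
`-log (1 - x + x² / 2) ≤ φ x ≤ log (1 + x + x² / 2)` for all `x`. -/
structure IsInfluenceFunction (φ : ℝ → ℝ) : Prop where
  monotone : Monotone φ
  lower : ∀ x, -Real.log (1 - x + x ^ 2 / 2) ≤ φ x
  upper : ∀ x, φ x ≤ Real.log (1 + x + x ^ 2 / 2)

/-- `ψ(A)`: apply `φ` to the eigenvalues in an eigendecomposition `Υ Λ Υᵀ` of the dilation of `A`
(this is what `Matrix.IsHermitian.cfc` does) and take the upper right block of the result. -/
noncomputable def psi {m n : Type*} [Fintype m] [Fintype n] [DecidableEq m] [DecidableEq n]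
    (φ : ℝ → ℝ) (A : Matrix m n ℝ) : Matrix m n ℝ :=
  ((dilation_isHermitian A).cfc φ).toBlocks₁₂

/-- The truncated response-score product `𝒯(y, S) = κ⁻¹ ψ(κ y S)`. -/
noncomputable def truncate {m n : Type*} [Fintype m] [Fintype n] [DecidableEq m] [DecidableEq n]
    (φ : ℝ → ℝ) (κ y : ℝ) (S : Matrix m n ℝ) : Matrix m n ℝ :=
  (1 / κ) • psi φ ((κ * y) • S)

/-! ### Fourth-order tensors -/

/-- Fourth-order tensors with all four dimensions equal to `d`. -/
abbrev Tensor (d : ℕ) : Type := Fin d → Fin d → Fin d → Fin d → ℝ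

/-- The inner product of two tensors. -/
def tensorInner {d : ℕ} (Z W : Tensor d) : ℝ :=
  ∑ j₁, ∑ j₂, ∑ j₃, ∑ j₄, Z j₁ j₂ j₃ j₄ * W j₁ j₂ j₃ j₄

/-- The Frobenius norm of a tensor. -/
noncomputable def tensorFrobNorm {d : ℕ} (Z : Tensor d) : ℝ := Real.sqrt (tensorInner Z Z)

/-- The rank-one tensor `u ⊗ v ⊗ s ⊗ t`. -/
def rankOne {d : ℕ} (u v s t : Fin d → ℝ) : Tensor d :=
  fun j₁ j₂ j₃ j₄ => u j₁ * v j₂ * s j₃ * t j₄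

/-- The CP-rank: the least `r` such that `Z` is a sum of `r` rank-one tensors. -/
noncomputable def cpRank {d : ℕ} (Z : Tensor d) : ℕ :=
  sInf {r : ℕ | ∃ u v s t : Fin r → Fin d → ℝ, Z = ∑ j, rankOne (u j) (v j) (s j) (t j)}

/-- The square unfolding of a fourth-order tensor. With indices starting from `0`, the entry with
row `k₁ = j₁ + j₂ d` and column `k₂ = j₃ + j₄ d` is `Z (j₁, j₂, j₃, j₄)`. -/
def mat {d : ℕ} (Z : Tensor d) : Matrix (Fin (d * d)) (Fin (d * d)) ℝ :=
  Matrix.of fun k₁ k₂ => Z k₁.modNat k₁.divNat k₂.modNat k₂.divNat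

/-! ### The single index model -/

/-- `p₀` is a differentiable probability density on the real line. -/
structure IsDifferentiableDensity (p₀ : ℝ → ℝ) : Prop where
  nonneg : ∀ u, 0 ≤ p₀ u
  integrable : Integrable p₀
  integral_eq_one : ∫ u, p₀ u = 1
  differentiable : Differentiable ℝ p₀

/-- The probability measure on the real line with density `p₀`. -/
noncomputable def densityMeasure (p₀ : ℝ → ℝ) : Measure ℝ :=
  (volume : Measure ℝ).withDensity fun u => ENNReal.ofReal (p₀ u)

/-- The univariate score function `s₀ = -p₀' / p₀`. -/
noncomputable def score (p₀ : ℝ → ℝ) (u : ℝ) : ℝ := -deriv p₀ u / p₀ u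

/-- The score function `S(x) = -∇ log p(x)` of the product density `p = p₀^{⊗ d⁴}`: the univariate
score applied to each entry of the tensor `x`. -/
noncomputable def tensorScore {d : ℕ} (p₀ : ℝ → ℝ) (x : Tensor d) : Tensor d :=
  fun j₁ j₂ j₃ j₄ => score p₀ (x j₁ j₂ j₃ j₄)

/-- The mean derivative `μ = 𝔼[f'(⟨X, β⟩)]`. -/
noncomputable def meanDeriv {d : ℕ} {Ω : Type*} [MeasurableSpace Ω] (P : Measure Ω)
    (X : Ω → Tensor d) (f : ℝ → ℝ) (β : Tensor d) : ℝ :=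
  ∫ ω, deriv f (tensorInner (X ω) β) ∂P

/-- The tensor single index model with first-order link `f`, parameter `β` and entrywise density
`p₀`: the response is `Y = f(⟨X, β⟩) + ε`, the entries of `X` are i.i.d. with density `p₀`, the
noise `ε` is centered and independent of `X`, `‖β‖ = 1`, and `𝔼[f'(⟨X, β⟩)]` exists and is
nonzero. -/
structure Model {d : ℕ} {Ω : Type*} [MeasurableSpace Ω] (P : Measure Ω) (p₀ f : ℝ → ℝ)
    (β : Tensor d) (X : Ω → Tensor d) (ε Y : Ω → ℝ) : Prop where
  density : IsDifferentiableDensity p₀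
  link_differentiable : Differentiable ℝ f
  measurable_X : Measurable X
  measurable_noise : Measurable ε
  response : ∀ ω, Y ω = f (tensorInner (X ω) β) + ε ω
  entries_indep : iIndepFun
    (fun (j : Fin d × Fin d × Fin d × Fin d) (ω : Ω) => X ω j.1 j.2.1 j.2.2.1 j.2.2.2) P
  entries_law : ∀ j₁ j₂ j₃ j₄, P.map (fun ω => X ω j₁ j₂ j₃ j₄) = densityMeasure p₀
  noise_indep : IndepFun X ε P
  noise_integrable : Integrable ε P
  noise_centered : ∫ ω, ε ω ∂P = 0
  frobNorm_eq_one : tensorFrobNorm β = 1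
  deriv_integrable : Integrable (fun ω => deriv f (tensorInner (X ω) β)) P
  meanDeriv_ne_zero : meanDeriv P X f β ≠ 0

/-- The fourth moments of the response and of the univariate score are at most `M`. -/
structure MomentBound {Ω : Type*} [MeasurableSpace Ω] (P : Measure Ω) (p₀ : ℝ → ℝ) (Y : Ω → ℝ)
    (M : ℝ) : Prop where
  response_integrable : Integrable (fun ω => Y ω ^ 4) P
  response_le : ∫ ω, Y ω ^ 4 ∂P ≤ M
  score_integrable : Integrable (fun u => score p₀ u ^ 4) (densityMeasure p₀)
  score_le : ∫ u, score p₀ u ^ 4 ∂(densityMeasure p₀) ≤ M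

/-- `(Xs i, Ys i)`, `i < n`, are `n` independent copies of `(X, Y)`. -/
structure IsSample {d n : ℕ} {Ω : Type*} [MeasurableSpace Ω] (P : Measure Ω) (X : Ω → Tensor d)
    (Y : Ω → ℝ) (Xs : Fin n → Ω → Tensor d) (Ys : Fin n → Ω → ℝ) : Prop where
  measurable_X : ∀ i, Measurable (Xs i)
  measurable_Y : ∀ i, Measurable (Ys i)
  indep : iIndepFun (fun i ω => (Xs i ω, Ys i ω)) P
  identDistrib : ∀ i, IdentDistrib (fun ω => (Xs i ω, Ys i ω)) (fun ω => (X ω, Y ω)) P P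

/-! ### The estimator -/

/-- The quadratic loss `L(B) = ⟨B, B⟩ - (2 / n) ∑ᵢ ⟨Tᵢ, B⟩`. -/
noncomputable def loss {m : Type*} [Fintype m] {n : ℕ} (T : Fin n → Matrix m m ℝ)
    (B : Matrix m m ℝ) : ℝ :=
  matInner B B - 2 / (n : ℝ) * ∑ i, matInner (T i) B

/-- The penalized objective `L(B) + reg * ‖B‖_⋆` of the data `(x i, y i)`, `i < n`, with
`Tᵢ = 𝒯(y i, Mat (S (x i)))`. -/
noncomputable def objective {d n : ℕ} (p₀ φ : ℝ → ℝ) (κ reg : ℝ) (x : Fin n → Tensor d)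
    (y : Fin n → ℝ) (B : Matrix (Fin (d * d)) (Fin (d * d)) ℝ) : ℝ :=
  loss (fun i => truncate φ κ (y i) (mat (tensorScore p₀ (x i)))) B + reg * nuclearNorm B

/-- `B` minimizes the penalized objective over all `d² × d²` matrices. -/
def IsEstimate {d n : ℕ} (p₀ φ : ℝ → ℝ) (κ reg : ℝ) (x : Fin n → Tensor d) (y : Fin n → ℝ)
    (B : Matrix (Fin (d * d)) (Fin (d * d)) ℝ) : Prop :=
  IsMinOn (objective p₀ φ κ reg x y) Set.univ B

/-- The truncation parameter `κ = 2 √(2 log d) / √(2 d² M n)`. -/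
noncomputable def kappa (d n : ℕ) (M : ℝ) : ℝ :=
  2 * Real.sqrt (2 * Real.log d) / Real.sqrt (2 * (d : ℝ) ^ 2 * M * n)

/-- The regularization parameter `λ = C √(2 M (2 d²) log d / n)`. -/
noncomputable def lam (C : ℝ) (d n : ℕ) (M : ℝ) : ℝ :=
  C * Real.sqrt (2 * M * (2 * (d : ℝ) ^ 2) * Real.log d / n)

end TensorSIM

namespace TensorSIM

open scoped Matrix

/-! ### The Lie–Trotter formula and the Golden–Thompson inequality -/

/-! Write B = μ Mat(β*) and T for the average of the 𝒯ᵢ. The loss is ⟨B', B'⟩ - 2⟨T, B'⟩, so the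
proof splits into a deterministic bound, valid once T - B is small in operator norm, and a
probabilistic bound on that norm.

Deterministic part (`frobNorm_sub_le_of_penalized`). If ‖T - B‖ ≤ t = λ/2, then comparing the
minimizer with B, and using a subgradient of the nuclear norm at B that cancels the part of the
noise off the row and column spaces of B, leaves only terms of rank at most r*. This gives the error
3√r* λ. The rank of B is at most r* because the square unfolding of a rank-one tensor is a matrix of
rank at most one (`rank_smul_mat_le_cpRank`).

Mean. Integration by parts in a single entry of X (Stein's identity) gives 𝔼[Y S(X)] = μ β*, so B is
the mean of Y Mat(S(X)).

Concentration (`measure_not_abs_sum_cfc_sub_le`). Let K be the dilation of κ Y Mat(S(X)). The fourth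
moments of Y and of the score give 𝔼 K² ≤ η I with η = 8 log d / n, while K need not have
exponential moments. The scalar sandwich |φ(x) - clip(x)| ≤ log(1 + 2x²) passes to quadratic forms.
The clipped matrices are bounded and satisfy a Bernstein-type bound; their bias is controlled by
|clip(x) - x| ≤ x²; and the exponential of log(1 + 2K²) is exactly 1 + 2K², so second moments
suffice for the remainder. Each tail comes from the Ahlswede–Winter argument, whose engine is the
Golden–Thompson inequality.

With deviation s = 27 log d, three exceptional events of probability at most 2d²(1 + 2η)ⁿ e^{-s}
each are discarded. Off them the quadratic form of ∑ φ(Kᵢ) - n 𝔼K is at most nη + 2s = 62 log d in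
absolute value on unit vectors. Division by nκ turns this into λ/2 exactly when C = 31. -/

theorem norm_pow_sub_pow_le {A : Type*} [NormedRing A] [NormOneClass A] {x y : A} {K : ℝ}
    (hx : ‖x‖ ≤ K) (hy : ‖y‖ ≤ K) (m : ℕ) :
    ‖x ^ (m + 1) - y ^ (m + 1)‖ ≤ (m + 1) * K ^ m * ‖x - y‖ := by
  have hK : 0 ≤ K := (norm_nonneg x).trans hx
  induction m with
  | zero => simp
  | succ m ih =>
    have h : x ^ (m + 1 + 1) - y ^ (m + 1 + 1)
        = x ^ (m + 1) * (x - y) + (x ^ (m + 1) - y ^ (m + 1)) * y := by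
      rw [pow_succ x (m + 1), pow_succ y (m + 1)]; noncomm_ring
    have h1 : ‖x ^ (m + 1) * (x - y)‖ ≤ K ^ (m + 1) * ‖x - y‖ :=
      (norm_mul_le _ _).trans (mul_le_mul_of_nonneg_right
        ((norm_pow_le _ _).trans (pow_le_pow_left₀ (norm_nonneg _) hx _)) (norm_nonneg _))
    have h2 : ‖(x ^ (m + 1) - y ^ (m + 1)) * y‖ ≤ (m + 1) * K ^ m * ‖x - y‖ * K :=
      (norm_mul_le _ _).trans (mul_le_mul ih hy (norm_nonneg _) (by positivity))
    rw [h]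
    refine (norm_add_le _ _).trans ((add_le_add h1 h2).trans (le_of_eq ?_))
    push_cast
    ring

theorem norm_exp_le_exp_norm {A : Type*} [NormedRing A] [NormOneClass A] [NormedAlgebra ℝ A]
    [CompleteSpace A] (x : A) : ‖NormedSpace.exp x‖ ≤ Real.exp ‖x‖ := by
  have h1 := NormedSpace.exp_series_hasSum_exp' (𝕂 := ℝ) x
  have h2 := NormedSpace.exp_series_hasSum_exp' (𝕂 := ℝ) ‖x‖
  rw [← Real.exp_eq_exp_ℝ] at h2
  rw [← h1.tsum_eq]
  refine tsum_of_norm_bounded h2 fun n => ?_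
  rw [norm_smul, smul_eq_mul, Real.norm_of_nonneg (by positivity)]
  exact mul_le_mul_of_nonneg_left (norm_pow_le _ _) (by positivity)

/-- The Lie–Trotter product formula. -/
theorem tendsto_exp_mul_exp_pow {A : Type*} [NormedRing A] [NormOneClass A] [NormedAlgebra ℝ A]
    [CompleteSpace A] (a b : A) :
    Filter.Tendsto (fun m : ℕ => (NormedSpace.exp (((m : ℝ) + 1)⁻¹ • a)
      * NormedSpace.exp (((m : ℝ) + 1)⁻¹ • b)) ^ (m + 1)) Filter.atTop
      (nhds (NormedSpace.exp (a + b))) := by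
  let _ : NormedAlgebra ℚ A := NormedAlgebra.restrictScalars ℚ ℝ A
  -- Both curves have derivative a + b at 0, so the one-step error is o(t). Telescoping multiplies
  -- it by m + 1 = 1/t and a bounded factor, which is why the slope at zero is the quantity to
  -- control.
  have hd : HasDerivAt (fun t : ℝ => NormedSpace.exp (t • (a + b))
      - NormedSpace.exp (t • a) * NormedSpace.exp (t • b)) 0 0 := by
    have h1 := hasDerivAt_exp_smul_const (𝕂 := ℝ) (a + b) (0 : ℝ)
    have h2 := hasDerivAt_exp_smul_const (𝕂 := ℝ) a (0 : ℝ)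
    have h3 := hasDerivAt_exp_smul_const (𝕂 := ℝ) b (0 : ℝ)
    have := h1.fun_sub (h2.fun_mul h3)
    simpa [NormedSpace.exp_zero] using this
  have hs := hasDerivAt_iff_tendsto_slope_zero.mp hd
  have ht : Filter.Tendsto (fun m : ℕ => ((m : ℝ) + 1)⁻¹) Filter.atTop (nhdsWithin 0 {0}ᶜ) := by
    refine tendsto_nhdsWithin_iff.mpr ⟨?_, Filter.Eventually.of_forall fun m => ?_⟩
    · simpa using tendsto_one_div_add_atTop_nhds_zero_nat (𝕜 := ℝ)
    · have : (0 : ℝ) < (m : ℝ) + 1 := by positivity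
      simp [this.ne']
  have h0 := (hs.comp ht).norm
  simp only [norm_zero] at h0
  have h0' := h0.const_mul (Real.exp (‖a‖ + ‖b‖))
  rw [mul_zero] at h0'
  rw [tendsto_iff_norm_sub_tendsto_zero]
  refine squeeze_zero (fun _ => norm_nonneg _) (fun m => ?_) h0'
  have hm : (0 : ℝ) < (m : ℝ) + 1 := by positivity
  set t : ℝ := ((m : ℝ) + 1)⁻¹ with ht_def
  have htpos : 0 < t := inv_pos.mpr hm
  have hpow : NormedSpace.exp (a + b) = NormedSpace.exp (t • (a + b)) ^ (m + 1) := by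
    rw [← NormedSpace.exp_nsmul, ← Nat.cast_smul_eq_nsmul ℝ, smul_smul]
    push_cast
    rw [ht_def, mul_inv_cancel₀ hm.ne', one_smul]
  have hK1 : ‖NormedSpace.exp (t • (a + b))‖ ≤ Real.exp (t * (‖a‖ + ‖b‖)) := by
    refine (norm_exp_le_exp_norm _).trans (Real.exp_le_exp.mpr ?_)
    rw [norm_smul, Real.norm_of_nonneg htpos.le]
    exact mul_le_mul_of_nonneg_left (norm_add_le _ _) htpos.le
  have hK2 : ‖NormedSpace.exp (t • a) * NormedSpace.exp (t • b)‖
      ≤ Real.exp (t * (‖a‖ + ‖b‖)) := by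
    refine (norm_mul_le _ _).trans ((mul_le_mul (norm_exp_le_exp_norm _) (norm_exp_le_exp_norm _)
      (norm_nonneg _) (Real.exp_pos _).le).trans (le_of_eq ?_))
    rw [← Real.exp_add, norm_smul, norm_smul, Real.norm_of_nonneg htpos.le]
    ring_nf
  have key := norm_pow_sub_pow_le hK2 hK1 m
  rw [hpow]
  refine key.trans ?_
  have hKm : Real.exp (t * (‖a‖ + ‖b‖)) ^ m ≤ Real.exp (‖a‖ + ‖b‖) := by
    rw [← Real.exp_nat_mul]
    refine Real.exp_le_exp.mpr ?_
    rw [← mul_assoc]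
    refine mul_le_of_le_one_left (by positivity) ?_
    rw [ht_def, ← div_eq_mul_inv, div_le_one hm]
    linarith
  simp only [Function.comp_apply, zero_add, zero_smul, NormedSpace.exp_zero, mul_one, sub_self,
    sub_zero, norm_smul, norm_inv]
  rw [Real.norm_of_nonneg hm.le, inv_inv, ← ht_def, norm_sub_rev]
  calc _ ≤ ((m : ℝ) + 1) * Real.exp (‖a‖ + ‖b‖) * _ := by gcongr
    _ = _ := by ring

/-! ### Trace inequalities for powers of two -/

section Trace

variable {N : Type*} [Fintype N] [DecidableEq N]

theorem trace_mul_pow_comm (A B : Matrix N N ℝ) (m : ℕ) :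
    ((A * B) ^ m).trace = ((B * A) ^ m).trace := by
  cases m with
  | zero => simp
  | succ m =>
    have h : SemiconjBy A (B * A) (A * B) := by simp [SemiconjBy, mul_assoc]
    have h2 := (h.pow_right m).eq
    rw [pow_succ, ← mul_assoc, ← h2, mul_assoc, Matrix.trace_mul_comm, pow_succ, mul_assoc]

theorem trace_mul_transpose_self_nonneg (M : Matrix N N ℝ) : 0 ≤ (M * M.transpose).trace := by
  simp only [Matrix.trace, Matrix.diag, Matrix.mul_apply, Matrix.transpose_apply]
  exact Finset.sum_nonneg fun i _ => Finset.sum_nonneg fun j _ => mul_self_nonneg _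

/-- Expand 0 ≤ ‖M - Kᵀ‖² in the Frobenius norm: Cauchy–Schwarz in additive form. -/
theorem trace_mul_le_of_transpose (M K : Matrix N N ℝ) :
    2 * (M * K).trace ≤ (M * M.transpose).trace + (K * K.transpose).trace := by
  have h := trace_mul_transpose_self_nonneg (M - K.transpose)
  rw [Matrix.transpose_sub, Matrix.transpose_transpose, sub_mul, mul_sub, mul_sub] at h
  simp only [Matrix.trace_sub] at h
  have h1 : (K.transpose * M.transpose).trace = (M * K).trace := by
    rw [← Matrix.transpose_mul, Matrix.trace_transpose]
  rw [h1, Matrix.trace_mul_comm K.transpose K] at h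
  linarith

/-- The two inequalities feed each other in the induction. The first at k + 1 is the second at k for
XY, then cyclicity of the trace, then the first at k for Y² and X². The second at k + 1 is the
second at k for M², cyclicity, the first at k for MMᵀ and MᵀM, and finally the additive
Cauchy–Schwarz inequality, both resulting squares having the same trace. -/
theorem trace_pow_two_pow_le (k : ℕ) :
    (∀ X Y : Matrix N N ℝ, X.IsSymm → Y.IsSymm →
      ((X * Y) ^ 2 ^ k).trace ≤ (X ^ 2 ^ k * Y ^ 2 ^ k).trace) ∧
    ∀ M : Matrix N N ℝ, (M ^ 2 ^ (k + 1)).trace ≤ ((M * M.transpose) ^ 2 ^ k).trace := by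
  have two : ∀ (k : ℕ) (M : Matrix N N ℝ), M ^ 2 ^ (k + 1) = (M * M) ^ 2 ^ k := fun k M => by
    rw [← pow_two, ← pow_mul, ← pow_succ']
  induction k with
  | zero =>
    refine ⟨fun X Y _ _ => by simp, fun M => ?_⟩
    have := trace_mul_le_of_transpose M M
    simp only [zero_add, pow_one, pow_zero, pow_two]
    linarith
  | succ k ih =>
    refine ⟨fun X Y hX hY => ?_, fun M => ?_⟩
    · refine (ih.2 (X * Y)).trans ?_
      rw [Matrix.transpose_mul, hX.eq, hY.eq, mul_assoc, trace_mul_pow_comm,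
        show Y * (Y * X) * X = (Y * Y) * (X * X) by noncomm_ring]
      refine (ih.1 (Y * Y) (X * X) ?_ ?_).trans ?_
      · rw [Matrix.IsSymm, Matrix.transpose_mul, hY.eq]
      · rw [Matrix.IsSymm, Matrix.transpose_mul, hX.eq]
      · rw [← two, ← two, Matrix.trace_mul_comm]
    · rw [two (k + 1)]
      refine (ih.2 (M * M)).trans ?_
      rw [Matrix.transpose_mul, mul_assoc, trace_mul_pow_comm,
        show M * (M.transpose * M.transpose) * M = (M * M.transpose) * (M.transpose * M) by
          noncomm_ring]
      have hP : (M * M.transpose).IsSymm := by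
        rw [Matrix.IsSymm, Matrix.transpose_mul, Matrix.transpose_transpose]
      have hQ : (M.transpose * M).IsSymm := by
        rw [Matrix.IsSymm, Matrix.transpose_mul, Matrix.transpose_transpose]
      refine (ih.1 _ _ hP hQ).trans ?_
      have h := trace_mul_le_of_transpose ((M * M.transpose) ^ 2 ^ k) ((M.transpose * M) ^ 2 ^ k)
      rw [(hP.pow _).eq, (hQ.pow _).eq, ← pow_add, ← pow_add, trace_mul_pow_comm M.transpose,
        ← two_mul (2 ^ k), ← pow_succ'] at h
      linarith

/-- The Golden–Thompson inequality for real symmetric matrices. -/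
theorem trace_exp_add_le (A B : Matrix N N ℝ) (hA : A.IsSymm) (hB : B.IsSymm) :
    (NormedSpace.exp (A + B)).trace ≤ (NormedSpace.exp A * NormedSpace.exp B).trace := by
  cases isEmpty_or_nonempty N with
  | inl h => simp [Matrix.trace]
  | inr h =>
  let _ : NormedRing (Matrix N N ℝ) := Matrix.linftyOpNormedRing
  let _ : NormedAlgebra ℝ (Matrix N N ℝ) := Matrix.linftyOpNormedAlgebra
  let _ : NormedAlgebra ℚ (Matrix N N ℝ) := NormedAlgebra.restrictScalars ℚ ℝ _
  have : NormOneClass (Matrix N N ℝ) := Matrix.linfty_opNormOneClass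
  have h := tendsto_exp_mul_exp_pow A B
  -- Only the exponents m + 1 = 2^k of the Trotter formula are used. For X = exp(A/2^k) and Y =
  -- exp(B/2^k) the bound tr(X^(2^k) Y^(2^k)) equals tr(exp A exp B), whatever k is.
  have hsub : Filter.Tendsto (fun k : ℕ => 2 ^ k - 1) Filter.atTop Filter.atTop :=
    (Filter.tendsto_sub_atTop_nat 1).comp (tendsto_pow_atTop_atTop_of_one_lt one_lt_two)
  have htr : Continuous (Matrix.trace : Matrix N N ℝ → ℝ) := continuous_id.matrix_trace
  have h2 := (htr.tendsto _).comp (h.comp hsub)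
  refine le_of_tendsto h2 (Filter.Eventually.of_forall fun k => ?_)
  have hk : 2 ^ k - 1 + 1 = 2 ^ k := Nat.sub_add_cancel Nat.one_le_two_pow
  simp only [Function.comp_apply]
  have hk' : (((2 ^ k - 1 : ℕ) : ℝ) + 1) = ((2 ^ k : ℕ) : ℝ) := by exact_mod_cast hk
  rw [hk, hk']
  have hexp : ∀ C : Matrix N N ℝ,
      NormedSpace.exp (((2 ^ k : ℕ) : ℝ)⁻¹ • C) ^ 2 ^ k = NormedSpace.exp C := fun C => by
    rw [← Matrix.exp_nsmul, ← Nat.cast_smul_eq_nsmul ℝ, smul_smul,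
      mul_inv_cancel₀ (by positivity), one_smul]
  have := (trace_pow_two_pow_le (N := N) k).1 _ _
    (Matrix.IsSymm.exp (hA.smul ((2 ^ k : ℕ) : ℝ)⁻¹))
    (Matrix.IsSymm.exp (hB.smul ((2 ^ k : ℕ) : ℝ)⁻¹))
  rwa [hexp, hexp] at this

end Trace

/-! ### Functional calculus of real symmetric matrices -/

section Spectral

variable {N : Type*} [Fintype N] [DecidableEq N] {A : Matrix N N ℝ} (hA : A.IsHermitian)

theorem cfc_apply_eq (f : ℝ → ℝ) (i j : N) :
    hA.cfc f i j = ∑ l, f (hA.eigenvalues l) * ((hA.eigenvectorUnitary : Matrix N N ℝ) i l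
      * (hA.eigenvectorUnitary : Matrix N N ℝ) j l) := by
  rw [Matrix.IsHermitian.cfc, Unitary.conjStarAlgAut_apply, Matrix.mul_apply]
  refine Finset.sum_congr rfl fun l _ => ?_
  simp only [Matrix.mul_diagonal, Matrix.star_apply, Function.comp_apply, star_trivial,
    RCLike.ofReal_real_eq_id, id_eq]
  ring

theorem cfc_mul_cfc (f g : ℝ → ℝ) : hA.cfc f * hA.cfc g = hA.cfc (fun x => f x * g x) := by
  simp only [Matrix.IsHermitian.cfc]
  rw [← map_mul, Matrix.diagonal_mul_diagonal]
  rfl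

theorem cfc_add_cfc (f g : ℝ → ℝ) : hA.cfc f + hA.cfc g = hA.cfc (fun x => f x + g x) := by
  ext i j
  simp only [Matrix.add_apply, cfc_apply_eq, ← Finset.sum_add_distrib, add_mul]

theorem smul_cfc (c : ℝ) (f : ℝ → ℝ) : c • hA.cfc f = hA.cfc (fun x => c * f x) := by
  ext i j
  simp only [Matrix.smul_apply, cfc_apply_eq, Finset.mul_sum, smul_eq_mul, mul_assoc]

theorem cfc_id_eq : hA.cfc (fun x => x) = A := by
  conv_rhs => rw [hA.spectral_theorem]
  rfl

theorem cfc_one_eq : hA.cfc (fun _ => 1) = 1 := by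
  have h : (Matrix.diagonal (RCLike.ofReal ∘ (fun _ => (1 : ℝ)) ∘ hA.eigenvalues) : Matrix N N ℝ)
      = 1 := by
    rw [← Matrix.diagonal_one]; rfl
  rw [Matrix.IsHermitian.cfc, h, map_one]

theorem cfc_sq_eq : hA.cfc (fun x => x ^ 2) = A * A := by
  conv_rhs => rw [← cfc_id_eq hA, cfc_mul_cfc]
  simp only [pow_two]

theorem cfc_isHermitian (f : ℝ → ℝ) : (hA.cfc f).IsHermitian := by
  ext i j
  simp only [Matrix.conjTranspose_apply, star_trivial, cfc_apply_eq]
  exact Finset.sum_congr rfl fun l _ => by ring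

theorem exp_cfc (f : ℝ → ℝ) :
    NormedSpace.exp (hA.cfc f) = hA.cfc (fun x => Real.exp (f x)) := by
  have hU : IsUnit (hA.eigenvectorUnitary : Matrix N N ℝ) :=
    (Unitary.toUnits hA.eigenvectorUnitary).isUnit
  have hinv : star (hA.eigenvectorUnitary : Matrix N N ℝ)
      = (hA.eigenvectorUnitary : Matrix N N ℝ)⁻¹ :=
    (Matrix.inv_eq_left_inv (Unitary.coe_star_mul_self hA.eigenvectorUnitary)).symm
  simp only [Matrix.IsHermitian.cfc, Unitary.conjStarAlgAut_apply]
  rw [hinv, Matrix.exp_conj _ _ hU, Matrix.exp_diagonal]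
  congr 3
  ext l
  simp [Real.exp_eq_exp_ℝ]

theorem exp_eq_cfc : NormedSpace.exp A = hA.cfc Real.exp := by
  conv_lhs => rw [← cfc_id_eq hA, exp_cfc]

/-- In the eigenbasis the quadratic form is a combination of the values of f at the eigenvalues,
with nonnegative weights that do not depend on f. This is how scalar inequalities become matrix
inequalities throughout. -/
theorem dotProduct_cfc_mulVec (f : ℝ → ℝ) (x : N → ℝ) :
    x ⬝ᵥ hA.cfc f *ᵥ x = ∑ l, f (hA.eigenvalues l)
      * (∑ i, x i * (hA.eigenvectorUnitary : Matrix N N ℝ) i l) ^ 2 := by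
  simp only [dotProduct, Matrix.mulVec, cfc_apply_eq, pow_two, Finset.mul_sum, Finset.sum_mul]
  rw [Finset.sum_comm' (t' := Finset.univ) (s' := fun _ => Finset.univ) (by simp)]
  rw [Finset.sum_congr rfl fun i _ => Finset.sum_comm, Finset.sum_comm]
  refine Finset.sum_congr rfl fun l _ => ?_
  refine Finset.sum_congr rfl fun i _ => Finset.sum_congr rfl fun j _ => ?_
  ring

theorem dotProduct_self_eq_sum (x : N → ℝ) :
    x ⬝ᵥ x = ∑ l, (∑ i, x i * (hA.eigenvectorUnitary : Matrix N N ℝ) i l) ^ 2 := by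
  have h := dotProduct_cfc_mulVec hA (fun _ => 1) x
  rw [cfc_one_eq, Matrix.one_mulVec] at h
  simpa using h

theorem dotProduct_cfc_mulVec_mono {f g : ℝ → ℝ} (h : ∀ x, f x ≤ g x) (x : N → ℝ) :
    x ⬝ᵥ hA.cfc f *ᵥ x ≤ x ⬝ᵥ hA.cfc g *ᵥ x := by
  rw [dotProduct_cfc_mulVec, dotProduct_cfc_mulVec]
  exact Finset.sum_le_sum fun l _ => mul_le_mul_of_nonneg_right (h _) (sq_nonneg _)

/-- A real symmetric matrix evaluated at a unit eigenvector. -/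
theorem exists_dotProduct_mulVec_eq_eigenvalue (l : N) :
    ∃ v : N → ℝ, v ⬝ᵥ v = 1 ∧ A *ᵥ v = hA.eigenvalues l • v ∧ v ⬝ᵥ A *ᵥ v = hA.eigenvalues l := by
  refine ⟨hA.eigenvectorBasis l, ?_, hA.mulVec_eigenvectorBasis l, ?_⟩
  · have h := hA.eigenvectorBasis.orthonormal.1 l
    have h2 := real_inner_self_eq_norm_sq (hA.eigenvectorBasis l)
    rw [h, one_pow, EuclideanSpace.inner_eq_star_dotProduct] at h2
    simpa using h2
  · have h := hA.eigenvectorBasis.orthonormal.1 l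
    have h2 := real_inner_self_eq_norm_sq (hA.eigenvectorBasis l)
    rw [h, one_pow, EuclideanSpace.inner_eq_star_dotProduct] at h2
    rw [hA.mulVec_eigenvectorBasis, dotProduct_smul]
    simp only [star_trivial] at h2
    rw [h2, smul_eq_mul, mul_one]

theorem trace_cfc (f : ℝ → ℝ) : (hA.cfc f).trace = ∑ l, f (hA.eigenvalues l) := by
  rw [Matrix.IsHermitian.cfc, Unitary.conjStarAlgAut_apply, Matrix.trace_mul_comm, ← mul_assoc,
    Unitary.coe_star_mul_self, one_mul, Matrix.trace_diagonal]
  rfl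

/-- The Laplace transform bound for the largest eigenvalue. -/
theorem exp_le_trace_exp (hA : A.IsHermitian) {s : ℝ} (h : ¬ ∀ x : N → ℝ, x ⬝ᵥ A *ᵥ x ≤ s * (x ⬝ᵥ x)) :
    Real.exp s ≤ (NormedSpace.exp A).trace := by
  rw [exp_eq_cfc hA, trace_cfc]
  by_contra hlt
  refine h fun x => ?_
  have hl : ∀ l, hA.eigenvalues l ≤ s := fun l => by
    by_contra hl
    refine hlt ((Real.exp_le_exp.mpr (not_le.mp hl).le).trans ?_)
    exact Finset.single_le_sum (f := fun l => Real.exp (hA.eigenvalues l))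
      (fun i _ => (Real.exp_pos _).le) (Finset.mem_univ l)
  have h1 := dotProduct_cfc_mulVec hA (fun x => x) x
  rw [cfc_id_eq] at h1
  rw [h1, dotProduct_self_eq_sum hA x, Finset.mul_sum]
  exact Finset.sum_le_sum fun l _ => mul_le_mul_of_nonneg_right (hl l) (sq_nonneg _)

theorem posSemidef_exp (hA : A.IsHermitian) : (NormedSpace.exp A).PosSemidef := by
  rw [exp_eq_cfc hA]
  refine Matrix.PosSemidef.of_dotProduct_mulVec_nonneg (cfc_isHermitian hA _) fun x => ?_
  rw [star_trivial, dotProduct_cfc_mulVec]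
  exact Finset.sum_nonneg fun l _ => mul_nonneg (Real.exp_pos _).le (sq_nonneg _)

theorem trace_exp_nonneg (hA : A.IsHermitian) : 0 ≤ (NormedSpace.exp A).trace := (posSemidef_exp hA).trace_nonneg

/-- The range |z| ≤ 2 is that of a centred matrix whose summand and mean both have norm at most 1.
Up to |z| = 1 this is Taylor's bound; on (1, 2] the chord of exp over [1, 2] suffices; below -1 the
left side is at most 1 and z + 2z² is positive. -/
theorem exp_le_one_add_add_sq {z : ℝ} (hz : |z| ≤ 2) : Real.exp z ≤ 1 + z + 2 * z ^ 2 := by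
  obtain ⟨h1, h2⟩ := abs_le.mp hz
  by_cases hz1 : |z| ≤ 1
  · have := Real.abs_exp_sub_one_sub_id_le hz1
    have := (abs_le.mp this).2
    nlinarith [sq_nonneg z]
  · have he : Real.exp 2 ≤ 8 := by
      have := Real.exp_one_lt_d9
      rw [show (2 : ℝ) = 1 + 1 by norm_num, Real.exp_add]
      nlinarith [Real.exp_pos 1]
    rcases le_or_gt 0 z with h0 | h0
    · have hz1' : 1 < z := by rwa [abs_of_nonneg h0, not_le] at hz1
      have hc := convexOn_exp.2 (Set.mem_univ 1) (Set.mem_univ 2)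
        (show (0 : ℝ) ≤ 2 - z by linarith [(abs_le.mp hz).2])
        (show (0 : ℝ) ≤ z - 1 by linarith) (by ring)
      simp only [smul_eq_mul, mul_one] at hc
      rw [show 2 - z + (z - 1) * 2 = z by ring] at hc
      have := Real.exp_one_lt_d9
      nlinarith [sq_nonneg (z - 1)]
    · have : Real.exp z ≤ 1 := Real.exp_le_one_iff.mpr h0.le
      rw [abs_of_neg h0, not_le] at hz1
      nlinarith

theorem dotProduct_exp_mulVec_le (hA : A.IsHermitian) (hb : ∀ x : N → ℝ, |x ⬝ᵥ A *ᵥ x| ≤ 2 * (x ⬝ᵥ x)) (x : N → ℝ) :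
    x ⬝ᵥ NormedSpace.exp A *ᵥ x ≤ x ⬝ᵥ x + x ⬝ᵥ A *ᵥ x + 2 * (x ⬝ᵥ (A * A) *ᵥ x) := by
  have hl : ∀ l, |hA.eigenvalues l| ≤ 2 := fun l => by
    obtain ⟨v, hv, -, hAv⟩ := exists_dotProduct_mulVec_eq_eigenvalue hA l
    simpa [hAv, hv] using hb v
  have h1 := dotProduct_cfc_mulVec hA (fun x => x) x
  have h2 := dotProduct_cfc_mulVec hA (fun x => x ^ 2) x
  rw [cfc_id_eq] at h1
  rw [cfc_sq_eq] at h2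
  rw [exp_eq_cfc hA, dotProduct_cfc_mulVec, h1, h2, dotProduct_self_eq_sum hA x, Finset.mul_sum,
    ← Finset.sum_add_distrib, ← Finset.sum_add_distrib]
  refine Finset.sum_le_sum fun l _ => ?_
  nlinarith [exp_le_one_add_add_sq (hl l),
    sq_nonneg (∑ i, x i * (hA.eigenvectorUnitary : Matrix N N ℝ) i l)]

theorem exists_eq_transpose_mul_self {P : Matrix N N ℝ} (hP : P.PosSemidef) :
    ∃ B : Matrix N N ℝ, P = Bᵀ * B := by
  refine ⟨hP.1.cfc Real.sqrt, ?_⟩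
  rw [← Matrix.conjTranspose_eq_transpose_of_trivial, (cfc_isHermitian hP.1 _).eq, cfc_mul_cfc]
  conv_lhs => rw [← cfc_id_eq hP.1]
  ext i j
  simp only [cfc_apply_eq]
  exact Finset.sum_congr rfl fun l _ => by rw [Real.mul_self_sqrt (hP.eigenvalues_nonneg l)]

/-- With P = BᵀB, the trace of PQ is the sum of the quadratic forms of Q at the rows of B, so an
upper bound on these forms is all that Q has to satisfy. -/
theorem trace_mul_le_of_posSemidef {P Q : Matrix N N ℝ} (hP : P.PosSemidef) {v : ℝ}
    (hQ : ∀ x : N → ℝ, x ⬝ᵥ Q *ᵥ x ≤ v * (x ⬝ᵥ x)) : (P * Q).trace ≤ v * P.trace := by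
  obtain ⟨B, rfl⟩ := exists_eq_transpose_mul_self hP
  rw [mul_assoc, Matrix.trace_mul_comm,
    Matrix.trace_mul_comm Bᵀ]
  simp only [Matrix.trace, Matrix.diag_apply, Finset.mul_sum]
  refine Finset.sum_le_sum fun i _ => ?_
  have h := hQ (B i)
  have h1 : (B * Q * Bᵀ) i i = B i ⬝ᵥ Q *ᵥ B i := by
    rw [Matrix.dotProduct_mulVec, Matrix.mul_apply']
    rfl
  rw [h1, Matrix.mul_apply']
  exact h

/-- Positivity of ∑ (B_li ± B_lj)² gives 2|P_ij| ≤ P_ii + P_jj. The bound serves to deduce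
integrability of every entry of a random matrix exponential from that of its trace. -/
theorem abs_apply_le_trace_of_posSemidef {P : Matrix N N ℝ} (hP : P.PosSemidef) (i j : N) :
    |P i j| ≤ P.trace := by
  obtain ⟨B, rfl⟩ := exists_eq_transpose_mul_self hP
  have hd : ∀ i, (Bᵀ * B) i i ≤ (Bᵀ * B).trace := fun i =>
    Finset.single_le_sum (f := fun i => (Bᵀ * B) i i)
      (fun i _ => hP.diag_nonneg) (Finset.mem_univ i)
  have h := Finset.sum_nonneg fun l (_ : l ∈ Finset.univ) => sq_nonneg (B l i - B l j)
  have h' := Finset.sum_nonneg fun l (_ : l ∈ Finset.univ) => sq_nonneg (B l i + B l j)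
  have hi := hd i
  have hj := hd j
  simp only [Matrix.mul_apply, Matrix.transpose_apply] at hi hj ⊢
  have e1 : ∑ l, (B l i - B l j) ^ 2
      = ∑ l, B l i * B l i + ∑ l, B l j * B l j - 2 * ∑ l, B l i * B l j := by
    rw [Finset.mul_sum, ← Finset.sum_add_distrib, ← Finset.sum_sub_distrib]
    exact Finset.sum_congr rfl fun l _ => by ring
  have e2 : ∑ l, (B l i + B l j) ^ 2
      = ∑ l, B l i * B l i + ∑ l, B l j * B l j + 2 * ∑ l, B l i * B l j := by
    rw [Finset.mul_sum, ← Finset.sum_add_distrib, ← Finset.sum_add_distrib]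
    exact Finset.sum_congr rfl fun l _ => by ring
  rw [e1] at h
  rw [e2] at h'
  exact abs_le.mpr ⟨by linarith, by linarith⟩

end Spectral

/-! ### Measurability of the functional calculus -/

/-- Approximate within 1/(k + 1) on [-k, k]: a fixed x lies in all but finitely many of these
intervals. Pointwise convergence is enough to pass measurability to the limit. -/
theorem exists_polynomial_tendsto {f : ℝ → ℝ} (hf : Continuous f) :
    ∃ p : ℕ → Polynomial ℝ, ∀ x, Filter.Tendsto (fun k => (p k).eval x) Filter.atTop
      (nhds (f x)) := by
  have h : ∀ k : ℕ, ∃ p : Polynomial ℝ, ∀ x ∈ Set.Icc (-(k : ℝ)) k,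
      |p.eval x - f x| < 1 / ((k : ℝ) + 1) := fun k =>
    exists_polynomial_near_of_continuousOn _ _ f hf.continuousOn _ Nat.one_div_pos_of_nat
  choose p hp using h
  refine ⟨p, fun x => ?_⟩
  rw [tendsto_iff_norm_sub_tendsto_zero]
  refine squeeze_zero' (Filter.Eventually.of_forall fun _ => norm_nonneg _) ?_
    (tendsto_one_div_add_atTop_nhds_zero_nat (𝕜 := ℝ))
  obtain ⟨k₀, hk₀⟩ := exists_nat_ge |x|
  filter_upwards [Filter.eventually_ge_atTop k₀] with k hk
  have hxk : |x| ≤ k := hk₀.trans (by exact_mod_cast hk)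
  exact (hp k x (abs_le.mp hxk)).le

section Measurability

variable {N : Type*} [Fintype N] [DecidableEq N] {E : Type*} [MeasurableSpace E]

theorem measurable_pow_apply {A : E → Matrix N N ℝ} (hm : ∀ i j, Measurable fun e => A e i j)
    (k : ℕ) (i j : N) : Measurable fun e => (A e ^ k) i j := by
  induction k generalizing i j with
  | zero => simp
  | succ k ih =>
    simp only [pow_succ, Matrix.mul_apply]
    exact Finset.measurable_fun_sum _ fun l _ => (ih i l).mul (hm l j)

/-- For a polynomial the functional calculus is a polynomial in the entries, so no measurable choice
of eigenvectors is needed; a continuous f is a pointwise limit of polynomials. An influence function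
may be discontinuous, which is one reason to work with `clip` and the logarithm instead. -/
theorem measurable_cfc_apply {A : E → Matrix N N ℝ} (hA : ∀ e, (A e).IsHermitian)
    (hm : ∀ i j, Measurable fun e => A e i j) {f : ℝ → ℝ} (hf : Continuous f) (i j : N) :
    Measurable fun e => (hA e).cfc f i j := by
  obtain ⟨p, hp⟩ := exists_polynomial_tendsto hf
  have hq : ∀ q : Polynomial ℝ, Measurable fun e => (hA e).cfc q.eval i j := fun q => by
    have h : (fun e => (hA e).cfc q.eval i j)
        = fun e => ∑ k ∈ Finset.range (q.natDegree + 1), q.coeff k * (A e ^ k) i j := by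
      funext e
      rw [← (hA e).cfc_eq, show cfc q.eval (A e) = Polynomial.aeval (A e) q from
        cfc_polynomial q (A e) (hA e), Polynomial.aeval_eq_sum_range, Matrix.sum_apply]
      rfl
    rw [h]
    exact Finset.measurable_fun_sum _ fun k _ =>
      (measurable_pow_apply hm k i j).const_mul (q.coeff k)
  refine measurable_of_tendsto_metrizable (fun k => hq (p k)) ?_
  refine tendsto_pi_nhds.mpr fun e => ?_
  simp only [cfc_apply_eq]
  exact tendsto_finsetSum _ fun l _ => (hp _).mul_const _

theorem measurable_exp_apply {A : E → Matrix N N ℝ} (hA : ∀ e, (A e).IsHermitian)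
    (hm : ∀ i j, Measurable fun e => A e i j) (i j : N) :
    Measurable fun e => NormedSpace.exp (A e) i j := by
  simp only [fun e => exp_eq_cfc (hA e)]
  exact measurable_cfc_apply hA hm Real.continuous_exp i j

end Measurability

/-! ### The Ahlswede–Winter tail bound -/

section Mean

variable {Ω : Type*} [MeasurableSpace Ω] {N : Type*} [Fintype N]

/-- The entrywise expectation of a random matrix. -/
noncomputable def meanMatrix (P : Measure Ω) (M : Ω → Matrix N N ℝ) : Matrix N N ℝ :=
  Matrix.of fun a b => ∫ ω, M ω a b ∂P

theorem dotProduct_mulVec_eq_sum (M : Matrix N N ℝ) (x : N → ℝ) :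
    x ⬝ᵥ M *ᵥ x = ∑ a, ∑ b, x a * x b * M a b := by
  simp only [dotProduct, Matrix.mulVec, Finset.mul_sum]
  exact Finset.sum_congr rfl fun a _ => Finset.sum_congr rfl fun b _ => by ring

variable {P : Measure Ω} {M : Ω → Matrix N N ℝ}

theorem integrable_dotProduct_mulVec (hM : ∀ a b, Integrable (fun ω => M ω a b) P) (x : N → ℝ) :
    Integrable (fun ω => x ⬝ᵥ M ω *ᵥ x) P := by
  simp only [dotProduct_mulVec_eq_sum]
  exact integrable_finsetSum _ fun a _ => integrable_finsetSum _ fun b _ => (hM a b).const_mul _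

theorem dotProduct_meanMatrix_mulVec (hM : ∀ a b, Integrable (fun ω => M ω a b) P) (x : N → ℝ) :
    x ⬝ᵥ meanMatrix P M *ᵥ x = ∫ ω, x ⬝ᵥ M ω *ᵥ x ∂P := by
  simp only [dotProduct_mulVec_eq_sum, meanMatrix, Matrix.of_apply]
  rw [integral_finsetSum _ fun a _ => integrable_finsetSum _ fun b _ => (hM a b).const_mul _]
  refine Finset.sum_congr rfl fun a _ => ?_
  rw [integral_finsetSum _ fun b _ => (hM a b).const_mul _]
  exact Finset.sum_congr rfl fun b _ => (integral_const_mul _ _).symm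

theorem isHermitian_meanMatrix (h : ∀ ω, (M ω).IsHermitian) : (meanMatrix P M).IsHermitian := by
  ext a b
  simp only [Matrix.conjTranspose_apply, star_trivial, meanMatrix, Matrix.of_apply]
  exact integral_congr_ae (Filter.Eventually.of_forall fun ω => by simpa using (h ω).apply a b)

theorem posSemidef_meanMatrix (hM : ∀ a b, Integrable (fun ω => M ω a b) P)
    (h : ∀ ω, (M ω).PosSemidef) : (meanMatrix P M).PosSemidef := by
  refine Matrix.PosSemidef.of_dotProduct_mulVec_nonneg
    (isHermitian_meanMatrix fun ω => (h ω).1) fun x => ?_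
  rw [star_trivial, dotProduct_meanMatrix_mulVec hM]
  exact integral_nonneg fun ω => by simpa using (h ω).dotProduct_mulVec_nonneg x

theorem trace_meanMatrix (hM : ∀ a b, Integrable (fun ω => M ω a b) P) :
    (meanMatrix P M).trace = ∫ ω, (M ω).trace ∂P := by
  simp only [Matrix.trace, Matrix.diag_apply, meanMatrix, Matrix.of_apply]
  rw [integral_finsetSum _ fun a _ => hM a a]

end Mean

section AhlswedeWinter

variable {Ω : Type*} [MeasurableSpace Ω] {P : Measure Ω} [IsProbabilityMeasure P]
  {N : Type*} [Fintype N] [DecidableEq N] {ι E : Type*} [MeasurableSpace E]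

theorem isHermitian_sum {g : E → Matrix N N ℝ} (hg : ∀ e, (g e).IsHermitian) {κ : Type*}
    (s : Finset κ) (w : κ → E) : (∑ i ∈ s, g (w i)).IsHermitian := by
  rw [Matrix.IsHermitian, Matrix.conjTranspose_sum]
  exact Finset.sum_congr rfl fun i _ => (hg _).eq

/-- Peel off one summand. Golden–Thompson separates its exponential from that of the others,
independence turns the expected trace into the trace of a product of two mean matrices, and the
bound v on the new one comes out because the other is positive semidefinite. The empty sum
contributes the trace of the identity. -/
theorem integral_trace_exp_sum_le {W : ι → Ω → E} (hW : ∀ i, Measurable (W i))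
    (hind : iIndepFun W P) {g : E → Matrix N N ℝ} (hg : ∀ e, (g e).IsHermitian)
    (hgm : ∀ a b, Measurable fun e => g e a b)
    (hint : ∀ i a b, Integrable (fun ω => NormedSpace.exp (g (W i ω)) a b) P) {v : ℝ}
    (hv0 : 0 ≤ v)
    (hv : ∀ i (x : N → ℝ), ∫ ω, x ⬝ᵥ NormedSpace.exp (g (W i ω)) *ᵥ x ∂P ≤ v * (x ⬝ᵥ x))
    (s : Finset ι) :
    Integrable (fun ω => (NormedSpace.exp (∑ i ∈ s, g (W i ω))).trace) P ∧
      ∫ ω, (NormedSpace.exp (∑ i ∈ s, g (W i ω))).trace ∂P ≤ Fintype.card N * v ^ s.card := by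
  classical
  induction s using Finset.induction_on with
  | empty => simp
  | insert i s hi ih =>
    have hsum : ∀ (t : Finset ι) a b,
        Measurable fun w : t → E => NormedSpace.exp (∑ j, g (w j)) a b := fun t a b => by
      refine measurable_exp_apply (fun w => isHermitian_sum hg _ _) (fun a b => ?_) a b
      simp only [Matrix.sum_apply]
      exact Finset.measurable_fun_sum _ fun j _ => (hgm a b).comp (measurable_pi_apply j)
    have hW' : ∀ t : Finset ι, Measurable fun ω (j : t) => W j ω := fun t =>
      measurable_pi_lambda _ fun j => hW j
    have hcoe : ∀ (t : Finset ι) ω, ∑ j : t, g (W j ω) = ∑ j ∈ t, g (W j ω) := fun t ω =>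
      Finset.sum_coe_sort t fun j => g (W j ω)
    have hSm : ∀ (t : Finset ι) a b,
        Measurable fun ω => NormedSpace.exp (∑ j ∈ t, g (W j ω)) a b := fun t a b => by
      simpa only [Function.comp_def, hcoe] using (hsum t a b).comp (hW' t)
    have hSi : ∀ a b, Integrable (fun ω => NormedSpace.exp (∑ j ∈ s, g (W j ω)) a b) P :=
      fun a b => ih.1.mono (hSm s a b).aestronglyMeasurable <|
        Filter.Eventually.of_forall fun ω => by
          have h := posSemidef_exp (isHermitian_sum hg s fun j => W j ω)
          rw [Real.norm_eq_abs, Real.norm_of_nonneg h.trace_nonneg]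
          exact abs_apply_le_trace_of_posSemidef h a b
    have hindep : ∀ a b c d, IndepFun (fun ω => NormedSpace.exp (∑ j ∈ s, g (W j ω)) a b)
        (fun ω => NormedSpace.exp (g (W i ω)) c d) P := fun a b c d => by
      have h := (hind.indepFun_finset s {i} (by simpa using hi) hW).comp (hsum s a b)
        (hsum {i} c d)
      have e : ∀ ω, ∑ j : ({i} : Finset ι), g (W j ω) = g (W i ω) := fun ω => by
        rw [hcoe, Finset.sum_singleton]
      simpa only [Function.comp_def, hcoe, e, Finset.sum_singleton] using h
    have hprod : ∀ ω, (NormedSpace.exp (∑ j ∈ s, g (W j ω)) * NormedSpace.exp (g (W i ω))).trace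
        = ∑ a, ∑ b, NormedSpace.exp (∑ j ∈ s, g (W j ω)) a b
          * NormedSpace.exp (g (W i ω)) b a := fun ω => by
      simp only [Matrix.trace, Matrix.diag_apply, Matrix.mul_apply]
    have hpi : ∀ a b, Integrable (fun ω => NormedSpace.exp (∑ j ∈ s, g (W j ω)) a b
          * NormedSpace.exp (g (W i ω)) b a) P := fun a b =>
      (hindep a b b a).integrable_mul (hSi a b) (hint i b a)
    have hGT : ∀ ω, (NormedSpace.exp (∑ j ∈ insert i s, g (W j ω))).trace
        ≤ (NormedSpace.exp (∑ j ∈ s, g (W j ω)) * NormedSpace.exp (g (W i ω))).trace := fun ω => by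
      rw [Finset.sum_insert hi, add_comm]
      have symm : ∀ {B : Matrix N N ℝ}, B.IsHermitian → B.IsSymm := fun {B} h => by
        rw [Matrix.IsSymm, ← Matrix.conjTranspose_eq_transpose_of_trivial]; exact h
      exact trace_exp_add_le _ _ (symm (isHermitian_sum hg s fun j => W j ω)) (symm (hg _))
    have hGTi : Integrable (fun ω => (NormedSpace.exp (∑ j ∈ s, g (W j ω))
        * NormedSpace.exp (g (W i ω))).trace) P := by
      simp only [hprod]
      exact integrable_finsetSum _ fun a _ => integrable_finsetSum _ fun b _ => hpi a b
    have h0 : ∀ ω, 0 ≤ (NormedSpace.exp (∑ j ∈ insert i s, g (W j ω))).trace := fun ω =>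
      trace_exp_nonneg (isHermitian_sum hg (insert i s) fun j => W j ω)
    have hI : Integrable (fun ω => (NormedSpace.exp (∑ j ∈ insert i s, g (W j ω))).trace) P := by
      refine hGTi.mono ?_ (Filter.Eventually.of_forall fun ω => ?_)
      · exact (Finset.measurable_fun_sum _ fun a _ => hSm _ a a).aestronglyMeasurable
      · rw [Real.norm_of_nonneg (h0 ω), Real.norm_of_nonneg ((h0 ω).trans (hGT ω))]
        exact hGT ω
    refine ⟨hI, (integral_mono hI hGTi hGT).trans ?_⟩
    have hfac : ∫ ω, (NormedSpace.exp (∑ j ∈ s, g (W j ω)) * NormedSpace.exp (g (W i ω))).trace ∂P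
        = (meanMatrix P (fun ω => NormedSpace.exp (∑ j ∈ s, g (W j ω)))
          * meanMatrix P (fun ω => NormedSpace.exp (g (W i ω)))).trace := by
      simp only [hprod]
      rw [integral_finsetSum _ fun a _ => integrable_finsetSum _ fun b _ => hpi a b]
      simp only [Matrix.trace, Matrix.diag_apply, Matrix.mul_apply]
      refine Finset.sum_congr rfl fun a _ => ?_
      rw [integral_finsetSum _ fun b _ => hpi a b]
      exact Finset.sum_congr rfl fun b _ => (hindep a b b a).integral_fun_mul_eq_mul_integral
        (hSm s a b).aestronglyMeasurable (hint i b a).aestronglyMeasurable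
    rw [hfac, Finset.card_insert_of_notMem hi, pow_succ]
    refine (trace_mul_le_of_posSemidef (v := v) (posSemidef_meanMatrix hSi fun ω =>
      posSemidef_exp (isHermitian_sum hg s fun j => W j ω)) fun x => ?_).trans ?_
    · rw [dotProduct_meanMatrix_mulVec (hint i)]
      exact hv i x
    · rw [trace_meanMatrix hSi]
      calc v * _ ≤ v * (Fintype.card N * v ^ s.card) := mul_le_mul_of_nonneg_left ih.2 hv0
        _ = _ := by ring

/-- The Ahlswede–Winter tail bound for a sum of independent random symmetric matrices. -/
theorem measure_not_sum_le [Fintype ι] {W : ι → Ω → E} (hW : ∀ i, Measurable (W i))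
    (hind : iIndepFun W P) {g : E → Matrix N N ℝ} (hg : ∀ e, (g e).IsHermitian)
    (hgm : ∀ a b, Measurable fun e => g e a b)
    (hint : ∀ i a b, Integrable (fun ω => NormedSpace.exp (g (W i ω)) a b) P) {v : ℝ}
    (hv0 : 0 ≤ v)
    (hv : ∀ i (x : N → ℝ), ∫ ω, x ⬝ᵥ NormedSpace.exp (g (W i ω)) *ᵥ x ∂P ≤ v * (x ⬝ᵥ x))
    (s : ℝ) :
    P {ω | ¬ ∀ x : N → ℝ, x ⬝ᵥ (∑ i, g (W i ω)) *ᵥ x ≤ s * (x ⬝ᵥ x)}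
      ≤ ENNReal.ofReal (Fintype.card N * v ^ Fintype.card ι * Real.exp (-s)) := by
  obtain ⟨hI, hle⟩ := integral_trace_exp_sum_le hW hind hg hgm hint hv0 hv Finset.univ
  have hM := mul_meas_ge_le_integral_of_nonneg (Filter.Eventually.of_forall fun ω =>
    trace_exp_nonneg (isHermitian_sum hg Finset.univ fun j => W j ω)) hI (Real.exp s)
  rw [Finset.card_univ] at hle
  refine (measure_mono (t := {ω | Real.exp s ≤ (NormedSpace.exp (∑ i, g (W i ω))).trace})
    fun ω hω => exp_le_trace_exp (isHermitian_sum hg Finset.univ fun j => W j ω) hω).trans ?_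
  rw [← ofReal_measureReal (measure_ne_top _ _)]
  refine ENNReal.ofReal_le_ofReal ?_
  rw [Real.exp_neg, ← div_eq_mul_inv, le_div_iff₀ (Real.exp_pos _), mul_comm]
  exact hM.trans hle

end AhlswedeWinter

/-! ### Nuclear norm duality and the deterministic error bound -/

section Deterministic

variable {m : Type*} [Fintype m]

theorem matInner_add_right (A B D : Matrix m m ℝ) :
    matInner A (B + D) = matInner A B + matInner A D := by
  simp [matInner, mul_add]

theorem matInner_add_left (A B D : Matrix m m ℝ) :
    matInner (A + B) D = matInner A D + matInner B D := by
  simp [matInner, add_mul]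

theorem matInner_smul_left (c : ℝ) (A B : Matrix m m ℝ) :
    matInner (c • A) B = c * matInner A B := by
  simp [matInner]

theorem matInner_comm (A B : Matrix m m ℝ) : matInner A B = matInner B A := by
  rw [matInner, ← Matrix.trace_transpose, Matrix.transpose_mul, Matrix.transpose_transpose,
    matInner]

theorem matInner_transpose (A B : Matrix m m ℝ) : matInner Aᵀ Bᵀ = matInner A B := by
  rw [matInner, Matrix.transpose_transpose, Matrix.trace_mul_comm, matInner_comm, matInner]

theorem matInner_eq_sum (A B : Matrix m m ℝ) : matInner A B = ∑ i, ∑ j, A i j * B i j := by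
  simp only [matInner, Matrix.trace, Matrix.diag_apply, Matrix.mul_apply, Matrix.transpose_apply]
  exact Finset.sum_comm

theorem frobNorm_sq (A : Matrix m m ℝ) : frobNorm A ^ 2 = matInner A A := by
  have h : 0 ≤ ∑ i, ∑ j, A i j ^ 2 :=
    Finset.sum_nonneg fun i _ => Finset.sum_nonneg fun j _ => sq_nonneg _
  rw [frobNorm, Real.sq_sqrt h, matInner_eq_sum]
  simp only [pow_two]

theorem frobNorm_nonneg (A : Matrix m m ℝ) : 0 ≤ frobNorm A := Real.sqrt_nonneg _

theorem matInner_le_frobNorm_mul (A B : Matrix m m ℝ) :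
    matInner A B ≤ frobNorm A * frobNorm B := by
  have h := Real.sum_mul_le_sqrt_mul_sqrt (Finset.univ : Finset (m × m))
    (fun p => A p.1 p.2) (fun p => B p.1 p.2)
  simpa only [matInner_eq_sum, frobNorm, Fintype.sum_prod_type] using h

theorem matInner_le_mul_frobNorm {A : Matrix m m ℝ} {c : ℝ} (hc : 0 ≤ c)
    (h : matInner A A ≤ c ^ 2) (B : Matrix m m ℝ) : matInner A B ≤ c * frobNorm B := by
  rw [← frobNorm_sq] at h
  exact (matInner_le_frobNorm_mul A B).trans
    (mul_le_mul_of_nonneg_right (abs_le_of_sq_le_sq' h hc).2 (frobNorm_nonneg B))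

theorem dotProduct_mulVec_self (A : Matrix m m ℝ) (v : m → ℝ) :
    (A *ᵥ v) ⬝ᵥ (A *ᵥ v) = v ⬝ᵥ (Aᵀ * A) *ᵥ v := by
  rw [← Matrix.mulVec_mulVec, Matrix.dotProduct_mulVec v, Matrix.vecMul_transpose]

theorem matInner_self_eq_sum_dotProduct (A : Matrix m m ℝ) :
    matInner A A = ∑ j, Aᵀ j ⬝ᵥ Aᵀ j := by
  rw [matInner_eq_sum, Finset.sum_comm]
  rfl

/-- Left multiplication acts column by column, and the squared Frobenius norm is the sum of the
squared column norms. -/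
theorem matInner_mul_self_le {E : Matrix m m ℝ} {t : ℝ}
    (hE : ∀ v, (E *ᵥ v) ⬝ᵥ (E *ᵥ v) ≤ t ^ 2 * (v ⬝ᵥ v)) (X : Matrix m m ℝ) :
    matInner (E * X) (E * X) ≤ t ^ 2 * matInner X X := by
  rw [matInner_self_eq_sum_dotProduct, matInner_self_eq_sum_dotProduct, Finset.mul_sum]
  exact Finset.sum_le_sum fun j _ => hE (Xᵀ j)

variable [DecidableEq m]

/-- Compute the trace in an orthonormal eigenbasis u_l of BᵀB: ⟨W, B⟩ = ∑ (W u_l)·(B u_l), where |W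
u_l| ≤ 1 and |B u_l| is the l-th singular value. -/
theorem matInner_le_nuclearNorm {W : Matrix m m ℝ} (hW : ∀ v, (W *ᵥ v) ⬝ᵥ (W *ᵥ v) ≤ v ⬝ᵥ v)
    (B : Matrix m m ℝ) : matInner W B ≤ nuclearNorm B := by
  set hH := Matrix.isHermitian_conjTranspose_mul_self B
  set U : Matrix m m ℝ := (hH.eigenvectorUnitary : Matrix m m ℝ)
  have hUU : Uᵀ * U = 1 := by
    have := Unitary.coe_star_mul_self hH.eigenvectorUnitary
    rwa [Matrix.star_eq_conjTranspose, Matrix.conjTranspose_eq_transpose_of_trivial] at this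
  have hUU' : U * Uᵀ = 1 := by
    exact mul_eq_one_comm.mp hUU
  have hdiag : ∀ l, (B *ᵥ (Uᵀ l)) ⬝ᵥ (B *ᵥ (Uᵀ l)) = hH.eigenvalues l := fun l => by
    rw [dotProduct_mulVec_self]
    have h1 : (Uᵀ * (Bᵀ * B) * U) l l = Uᵀ l ⬝ᵥ (Bᵀ * B) *ᵥ Uᵀ l := by
      rw [Matrix.dotProduct_mulVec, Matrix.mul_apply']
      rfl
    have h2 : Bᵀ * B = U * Matrix.diagonal hH.eigenvalues * Uᵀ := by
      have := hH.spectral_theorem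
      rw [Unitary.conjStarAlgAut_apply, Matrix.star_eq_conjTranspose,
        Matrix.conjTranspose_eq_transpose_of_trivial
          (hH.eigenvectorUnitary : Matrix m m ℝ)] at this
      exact (congrArg (· * B) (Matrix.conjTranspose_eq_transpose_of_trivial B)).symm.trans this
    rw [← h1, h2, show Uᵀ * (U * Matrix.diagonal hH.eigenvalues * Uᵀ) * U
      = (Uᵀ * U) * Matrix.diagonal hH.eigenvalues * (Uᵀ * U) by simp only [mul_assoc],
      hUU, one_mul, mul_one, Matrix.diagonal_apply_eq]
  have hone : ∀ l, Uᵀ l ⬝ᵥ Uᵀ l = 1 := fun l => by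
    have := congrFun (congrFun hUU l) l
    rwa [Matrix.one_apply_eq, Matrix.mul_apply'] at this
  have key : matInner W B = ∑ l, (W *ᵥ (Uᵀ l)) ⬝ᵥ (B *ᵥ (Uᵀ l)) := by
    have h : matInner W B = matInner (W * U) (B * U) := by
      rw [matInner, matInner, Matrix.transpose_mul, Matrix.mul_assoc, Matrix.trace_mul_comm Uᵀ,
        Matrix.mul_assoc, Matrix.mul_assoc, hUU', Matrix.mul_one]
    rw [h, matInner_eq_sum, Finset.sum_comm]
    rfl
  rw [key, nuclearNorm]
  refine Finset.sum_le_sum fun l _ => ?_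
  have hcs := Real.sum_mul_le_sqrt_mul_sqrt Finset.univ (W *ᵥ (Uᵀ l)) (B *ᵥ (Uᵀ l))
  have hW1 : √(∑ i, (W *ᵥ (Uᵀ l)) i ^ 2) ≤ 1 := by
    rw [Real.sqrt_le_one]
    have := hW (Uᵀ l)
    rw [hone l] at this
    simpa only [dotProduct, pow_two] using this
  have hB1 : ∑ i, (B *ᵥ (Uᵀ l)) i ^ 2 = hH.eigenvalues l := by
    rw [← hdiag l]
    simp only [dotProduct, pow_two]
  rw [hB1] at hcs
  exact hcs.trans (mul_le_of_le_one_left (Real.sqrt_nonneg _) hW1)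

theorem cfc_congr_eigenvalues {H : Matrix m m ℝ} (hH : H.IsHermitian) {f g : ℝ → ℝ}
    (h : ∀ l, f (hH.eigenvalues l) = g (hH.eigenvalues l)) : hH.cfc f = hH.cfc g := by
  ext i j
  simp only [cfc_apply_eq, h]

/-- The partial isometry of the polar decomposition. -/
theorem exists_partialIsometry (A : Matrix m m ℝ) :
    ∃ W : Matrix m m ℝ, matInner W A = nuclearNorm A ∧ W * (Wᵀ * W) = W ∧ W * Wᵀ * A = A ∧
      (Wᵀ * W).trace = A.rank := by
  set hH := Matrix.isHermitian_conjTranspose_mul_self A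
  have hpos : ∀ l, 0 ≤ hH.eigenvalues l :=
    (Matrix.posSemidef_conjTranspose_mul_self A).eigenvalues_nonneg
  have hAA : Aᵀ * A = hH.cfc (fun x => x) := by
    rw [cfc_id_eq, Matrix.conjTranspose_eq_transpose_of_trivial]
  have hT : ∀ f, (hH.cfc f)ᵀ = hH.cfc f := fun f => by
    rw [← Matrix.conjTranspose_eq_transpose_of_trivial, (cfc_isHermitian hH f).eq]
  -- The witness is W = A g(AᵀA) with g(x) = x^(-1/2). The convention 0⁻¹ = 0 makes g the
  -- pseudo-inverse square root, and q, the indicator of x ≠ 0, gives the projection WᵀW, whose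
  -- trace counts the nonzero eigenvalues.
  set g : ℝ → ℝ := fun x => (√x)⁻¹
  set q : ℝ → ℝ := fun x => if x = 0 then 0 else 1
  have hgg : ∀ x, 0 ≤ x → g x * (x * g x) = q x := fun x hx => by
    rcases hx.eq_or_lt with h | h
    · simp [g, q, ← h]
    · have hs := Real.sqrt_pos.mpr h
      have := Real.mul_self_sqrt hx
      simp only [g, q, h.ne', if_false]
      field_simp
      linarith
  -- The zero is written `0 * 1` so that `smul_cfc` can pull it out as a scalar.
  have hqx : ∀ x, (1 - q x) * (x * (1 - q x)) = 0 * 1 := fun x => by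
    by_cases h : x = 0 <;> simp [q, h]
  have hgq : ∀ x, g x * q x = g x := fun x => by
    by_cases h : x = 0 <;> simp [q, g, h]
  have hgx : ∀ x, 0 ≤ x → g x * x = √x := fun x hx => by
    rcases hx.eq_or_lt with h | h
    · rw [← h]; simp
    · have hs := Real.sqrt_pos.mpr h
      have := Real.mul_self_sqrt hx
      simp only [g]
      rw [inv_mul_eq_div, div_eq_iff hs.ne', this]
  have hWW : (A * hH.cfc g)ᵀ * (A * hH.cfc g) = hH.cfc q := by
    rw [Matrix.transpose_mul, hT, mul_assoc, ← mul_assoc Aᵀ, hAA, cfc_mul_cfc, cfc_mul_cfc]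
    exact cfc_congr_eigenvalues hH fun l => hgg _ (hpos l)
  -- The Gram matrix of A(1 - q(AᵀA)) is the functional calculus of x(1 - q(x))², which vanishes.
  have hAq : A * hH.cfc q = A := by
    have h : (A * (1 - hH.cfc q))ᴴ * (A * (1 - hH.cfc q)) = 0 := by
      have h1 : 1 - hH.cfc q = hH.cfc (fun x => 1 - q x) := by
        rw [sub_eq_iff_eq_add, cfc_add_cfc]
        simp only [sub_add_cancel, cfc_one_eq]
      rw [h1, Matrix.conjTranspose_eq_transpose_of_trivial, Matrix.transpose_mul, hT, mul_assoc,
        ← mul_assoc Aᵀ, hAA, cfc_mul_cfc, cfc_mul_cfc]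
      rw [cfc_congr_eigenvalues hH (g := fun _ => (0 : ℝ) * 1), ← smul_cfc, zero_smul]
      exact fun l => hqx _
    have h0 := Matrix.conjTranspose_mul_self_eq_zero.mp h
    rw [mul_sub, mul_one, sub_eq_zero] at h0
    exact h0.symm
  refine ⟨A * hH.cfc g, ?_, ?_, ?_, ?_⟩
  · rw [matInner, Matrix.transpose_mul, hT, mul_assoc, hAA, cfc_mul_cfc, trace_cfc, nuclearNorm]
    exact Finset.sum_congr rfl fun l _ => hgx _ (hpos l)
  · rw [hWW, mul_assoc, cfc_mul_cfc]
    congr 1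
    exact cfc_congr_eigenvalues hH fun l => hgq _
  · rw [Matrix.transpose_mul, hT, mul_assoc, mul_assoc, mul_assoc, hAA, cfc_mul_cfc, cfc_mul_cfc]
    conv_rhs => rw [← hAq]
    congr 1
    refine cfc_congr_eigenvalues hH fun l => ?_
    rw [← hgg _ (hpos l)]
    ring
  · rw [hWW, trace_cfc, ← Matrix.rank_conjTranspose_mul_self A, hH.rank_eq_card_non_zero_eigs,
      Fintype.card_subtype]
    simp only [q, Finset.sum_ite, Finset.sum_const_zero, zero_add, Finset.sum_const,
      nsmul_eq_mul, mul_one]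

/-- The error bound for nuclear norm penalized least squares. -/
theorem frobNorm_sub_le_of_penalized {B T Bhat : Matrix m m ℝ} {t : ℝ} {r : ℕ} (ht : 0 < t)
    (hrank : B.rank ≤ r)
    (hE : ∀ v, ((T - B) *ᵥ v) ⬝ᵥ ((T - B) *ᵥ v) ≤ t ^ 2 * (v ⬝ᵥ v))
    (hE' : ∀ v, ((T - B)ᵀ *ᵥ v) ⬝ᵥ ((T - B)ᵀ *ᵥ v) ≤ t ^ 2 * (v ⬝ᵥ v))
    (hmin : matInner Bhat Bhat - 2 * matInner T Bhat + 2 * t * nuclearNorm Bhat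
      ≤ matInner B B - 2 * matInner T B + 2 * t * nuclearNorm B) :
    frobNorm (Bhat - B) ≤ 3 * √r * (2 * t) := by
  obtain ⟨W, hW1, hW2, hW3, hW4⟩ := exists_partialIsometry B
  set E := T - B with hEdef
  have hTE : T = E + B := by rw [hEdef, sub_add_cancel]
  set D := Bhat - B with hD
  have hBD : Bhat = B + D := by rw [hD, add_sub_cancel]
  set Q := Wᵀ * W with hQ
  set R := W * Wᵀ with hR
  have hQT : Qᵀ = Q := by rw [hQ, Matrix.transpose_mul, Matrix.transpose_transpose]
  have hRT : Rᵀ = R := by rw [hR, Matrix.transpose_mul, Matrix.transpose_transpose]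
  have hQQ : Q * Q = Q := by
    conv_lhs => rw [hQ, mul_assoc, ← hQ, hW2]
  have hRW : R * W = W := by rw [hR, mul_assoc, ← hQ, hW2]
  have hWR : Wᵀ * R = Wᵀ := by
    have := congrArg Matrix.transpose hRW
    rwa [Matrix.transpose_mul, hRT] at this
  have hRR : R * R = R := by
    conv_lhs => rw [hR, mul_assoc, ← hR, hWR]
  have hproj : ∀ (S : Matrix m m ℝ), Sᵀ = S → S * S = S → ∀ v : m → ℝ,
      (S *ᵥ v) ⬝ᵥ (S *ᵥ v) = v ⬝ᵥ S *ᵥ v := fun S h1 h2 v => by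
    rw [dotProduct_mulVec_self, h1, h2]
  have hcompl : ∀ (S : Matrix m m ℝ), Sᵀ = S → S * S = S → ∀ v : m → ℝ,
      ((1 - S) *ᵥ v) ⬝ᵥ ((1 - S) *ᵥ v) = v ⬝ᵥ v - v ⬝ᵥ S *ᵥ v := fun S h1 h2 v => by
    rw [hproj (1 - S) (by rw [Matrix.transpose_sub, h1, Matrix.transpose_one])
      (by simp [sub_mul, mul_sub, h2]), Matrix.sub_mulVec, Matrix.one_mulVec, dotProduct_sub]
  have hcompl_le : ∀ v : m → ℝ, ((1 - R) *ᵥ v) ⬝ᵥ ((1 - R) *ᵥ v) ≤ v ⬝ᵥ v := fun v => by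
    rw [hcompl R hRT hRR, ← hproj R hRT hRR]
    have : 0 ≤ (R *ᵥ v) ⬝ᵥ (R *ᵥ v) := Finset.sum_nonneg fun i _ => mul_self_nonneg _
    linarith
  -- F is the noise off the column space (projection R) and the row space (projection Q) of B. W and
  -- F have orthogonal ranges, W depends only on Qv and F only on (1 - Q)v, so W + t⁻¹F is a
  -- contraction; since FᵀB = 0 it is a subgradient of the nuclear norm at B. Its pairing with D =
  -- Bhat - B, multiplied by 2t, cancels the term 2⟨F, D⟩ of the noise exactly.
  set F := (1 - R) * E * (1 - Q) with hF
  have hcontr : ∀ v : m → ℝ,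
      ((W + t⁻¹ • F) *ᵥ v) ⬝ᵥ ((W + t⁻¹ • F) *ᵥ v) ≤ v ⬝ᵥ v := fun v => by
    have horth : (W *ᵥ v) ⬝ᵥ (F *ᵥ v) = 0 := by
      have h0 : Wᵀ * F = 0 := by
        rw [hF, ← mul_assoc, ← mul_assoc, mul_sub Wᵀ, mul_one, hWR, sub_self, zero_mul, zero_mul]
      rw [← Matrix.vecMul_transpose, ← Matrix.dotProduct_mulVec, Matrix.mulVec_mulVec, h0,
        Matrix.zero_mulVec, dotProduct_zero]
    have hWv : (W *ᵥ v) ⬝ᵥ (W *ᵥ v) = v ⬝ᵥ Q *ᵥ v := dotProduct_mulVec_self W v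
    have hFv : (F *ᵥ v) ⬝ᵥ (F *ᵥ v) ≤ t ^ 2 * (v ⬝ᵥ v - v ⬝ᵥ Q *ᵥ v) := by
      rw [hF, ← Matrix.mulVec_mulVec, ← Matrix.mulVec_mulVec, ← hcompl Q hQT hQQ]
      exact (hcompl_le _).trans (hE _)
    have hexp : ((W + t⁻¹ • F) *ᵥ v) ⬝ᵥ ((W + t⁻¹ • F) *ᵥ v)
        = (W *ᵥ v) ⬝ᵥ (W *ᵥ v) + 2 * t⁻¹ * ((W *ᵥ v) ⬝ᵥ (F *ᵥ v))
          + (t⁻¹) ^ 2 * ((F *ᵥ v) ⬝ᵥ (F *ᵥ v)) := by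
      simp only [Matrix.add_mulVec, Matrix.smul_mulVec, add_dotProduct, dotProduct_add,
        smul_dotProduct, dotProduct_smul, smul_eq_mul, dotProduct_comm (F *ᵥ v) (W *ᵥ v)]
      ring
    rw [hexp, horth, hWv]
    have := mul_le_mul_of_nonneg_left hFv (sq_nonneg t⁻¹)
    rw [← mul_assoc, ← mul_pow, inv_mul_cancel₀ ht.ne', one_pow, one_mul] at this
    linarith
  have hdual := matInner_le_nuclearNorm hcontr Bhat
  have hFB : matInner F B = 0 := by
    rw [matInner, hF, Matrix.transpose_mul, Matrix.transpose_mul, mul_assoc, mul_assoc,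
      Matrix.transpose_sub 1 R, hRT, Matrix.transpose_one, sub_mul, one_mul, hW3, sub_self, mul_zero,
      mul_zero, Matrix.trace_zero]
  rw [hBD, matInner_add_left, matInner_smul_left, matInner_add_right, matInner_add_right, hFB,
    zero_add, hW1, ← hBD] at hdual
  have hQtr : matInner Q Q ≤ r := by
    rw [matInner, hQT, hQQ, hW4]; exact_mod_cast hrank
  have hWtr : matInner W W ≤ r := by
    rw [matInner, ← hQ, hW4]; exact_mod_cast hrank
  have hRtr : matInner R R ≤ r := by
    rw [matInner, hRT, hRR, hR, Matrix.trace_mul_comm, ← hQ, hW4]; exact_mod_cast hrank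
  have hsq : √(r : ℝ) ^ 2 = r := Real.sq_sqrt (Nat.cast_nonneg r)
  -- The projection stands on the left of E, so the norm is computed for the transpose EᵀR; this is
  -- where the bound on Eᵀ enters.
  have h1 : matInner (R * E) D ≤ t * √r * frobNorm D := by
    refine matInner_le_mul_frobNorm (by positivity) ?_ D
    rw [← matInner_transpose, Matrix.transpose_mul, hRT, mul_pow, hsq]
    exact (matInner_mul_self_le hE' R).trans (mul_le_mul_of_nonneg_left hRtr (sq_nonneg t))
  have h2 : matInner ((1 - R) * (E * Q)) D ≤ t * √r * frobNorm D := by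
    refine matInner_le_mul_frobNorm (by positivity) ?_ D
    rw [mul_pow, hsq]
    have ha := matInner_mul_self_le (t := 1)
      (fun v => by simpa only [one_pow, one_mul] using hcompl_le v) (E * Q)
    rw [one_pow, one_mul] at ha
    exact ha.trans ((matInner_mul_self_le hE Q).trans
      (mul_le_mul_of_nonneg_left hQtr (sq_nonneg t)))
  have h3 : matInner ((-1 : ℝ) • W) D ≤ √r * frobNorm D := by
    refine matInner_le_mul_frobNorm (by positivity) ?_ D
    rw [matInner_smul_left, matInner_comm, matInner_smul_left, hsq]
    linarith
  rw [matInner_smul_left] at h3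
  have hEF : matInner E D = matInner F D + matInner (R * E) D
      + matInner ((1 - R) * (E * Q)) D := by
    rw [← matInner_add_left, ← matInner_add_left]
    congr 1
    rw [hF]
    noncomm_ring
  have hquad : matInner D D ≤ 2 * matInner E D + 2 * t * (nuclearNorm B - nuclearNorm Bhat) := by
    rw [hTE, hBD] at hmin
    simp only [matInner_add_left, matInner_add_right, matInner_comm D B] at hmin
    rw [← hBD] at hmin
    linarith
  have hd2 : 2 * t * (nuclearNorm B + (matInner W D + t⁻¹ * matInner F D))
      ≤ 2 * t * nuclearNorm Bhat := mul_le_mul_of_nonneg_left (by linarith) (by positivity)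
  have htt : 2 * t * (nuclearNorm B + (matInner W D + t⁻¹ * matInner F D))
      = 2 * t * nuclearNorm B + 2 * t * matInner W D + 2 * matInner F D := by
    field_simp
    ring
  have h3' := mul_le_mul_of_nonneg_left h3 (show 0 ≤ 2 * t by positivity)
  -- The pieces R E, (1 - R) E Q and t W contribute 2t√r ‖D‖ each.
  have hfin : frobNorm D ^ 2 ≤ 3 * √r * (2 * t) * frobNorm D := by
    rw [frobNorm_sq]
    linarith
  rcases (frobNorm_nonneg D).eq_or_lt with h | h
  · rw [← h]; positivity
  · rw [pow_two] at hfin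
    exact le_of_mul_le_mul_right hfin h

end Deterministic

/-! ### Stein's identity for the score function -/

theorem integrable_densityMeasure_iff {p₀ : ℝ → ℝ} (hp : IsDifferentiableDensity p₀)
    {g : ℝ → ℝ} : Integrable g (densityMeasure p₀) ↔ Integrable fun u => p₀ u * g u := by
  have hm : Measurable fun u => ENNReal.ofReal (p₀ u) :=
    hp.differentiable.continuous.measurable.ennreal_ofReal
  rw [densityMeasure, integrable_withDensity_iff_integrable_smul' hm
    (Filter.Eventually.of_forall fun u => ENNReal.ofReal_lt_top)]
  simp only [ENNReal.toReal_ofReal (hp.nonneg _), smul_eq_mul]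

theorem integral_densityMeasure {p₀ : ℝ → ℝ} (hp : IsDifferentiableDensity p₀) (g : ℝ → ℝ) :
    ∫ u, g u ∂densityMeasure p₀ = ∫ u, p₀ u * g u := by
  have hm : Measurable fun u => ENNReal.ofReal (p₀ u) :=
    hp.differentiable.continuous.measurable.ennreal_ofReal
  rw [densityMeasure, integral_withDensity_eq_integral_toReal_smul hm
    (Filter.Eventually.of_forall fun u => ENNReal.ofReal_lt_top)]
  simp only [ENNReal.toReal_ofReal (hp.nonneg _), smul_eq_mul]

theorem measurable_score (p₀ : ℝ → ℝ) (hp : Measurable p₀) : Measurable (score p₀) :=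
  (measurable_deriv p₀).neg.div hp

/-- At a zero of p₀ the quotient is 0 by convention; there the nonnegative p₀ has a minimum, so p₀'
vanishes as well. -/
theorem mul_score {p₀ : ℝ → ℝ} (hp : IsDifferentiableDensity p₀) (u : ℝ) :
    p₀ u * score p₀ u = -deriv p₀ u := by
  by_cases h : p₀ u = 0
  · have hmin : IsLocalMin p₀ u := Filter.Eventually.of_forall fun w => by
      rw [h]; exact hp.nonneg w
    rw [h, hmin.deriv_eq_zero, zero_mul, neg_zero]
  · rw [score, mul_div_cancel₀ _ h]

/-- The derivative of p₀ h is p₀ h' - p₀ h s₀. It and p₀ h are integrable on the line, so its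
integral vanishes without any separate decay condition at infinity. -/
theorem integral_mul_score {p₀ h : ℝ → ℝ} (hp : IsDifferentiableDensity p₀)
    (hd : Differentiable ℝ h) (hi : Integrable h (densityMeasure p₀))
    (hi' : Integrable (deriv h) (densityMeasure p₀))
    (his : Integrable (fun u => h u * score p₀ u) (densityMeasure p₀)) :
    ∫ u, h u * score p₀ u ∂densityMeasure p₀ = ∫ u, deriv h u ∂densityMeasure p₀ := by
  rw [integrable_densityMeasure_iff hp] at hi hi' his
  rw [integral_densityMeasure hp, integral_densityMeasure hp]
  have hder : ∀ u, HasDerivAt (fun u => p₀ u * h u)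
      (p₀ u * deriv h u - p₀ u * (h u * score p₀ u)) u := fun u => by
    have := (hp.differentiable u).hasDerivAt.fun_mul (hd u).hasDerivAt
    refine this.congr_deriv ?_
    linear_combination h u * mul_score hp u
  have h0 := integral_eq_zero_of_hasDerivAt_of_integrable hder (hi'.sub his) hi
  rw [integral_sub hi' his] at h0
  linarith

section Stein

variable {Ω : Type*} [MeasurableSpace Ω] {P : Measure Ω} [IsProbabilityMeasure P]

/-- Stein's identity for `f (b U + T)`, where `U` has density `p₀` and is independent of `T`. -/
theorem integral_comp_mul_score {p₀ f : ℝ → ℝ} (hp : IsDifferentiableDensity p₀)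
    (hf : Differentiable ℝ f) {U T : Ω → ℝ} (hU : Measurable U) (hT : Measurable T)
    (hUT : IndepFun T U P) (hlaw : P.map U = densityMeasure p₀) (b : ℝ)
    (hi : Integrable (fun ω => f (b * U ω + T ω)) P)
    (hi' : Integrable (fun ω => deriv f (b * U ω + T ω)) P)
    (his : Integrable (fun ω => f (b * U ω + T ω) * score p₀ (U ω)) P) :
    ∫ ω, f (b * U ω + T ω) * score p₀ (U ω) ∂P = b * ∫ ω, deriv f (b * U ω + T ω) ∂P := by
  have : IsProbabilityMeasure (P.map U) := Measure.isProbabilityMeasure_map hU.aemeasurable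
  have : IsProbabilityMeasure (densityMeasure p₀) := hlaw ▸ this
  have : IsProbabilityMeasure (P.map T) := Measure.isProbabilityMeasure_map hT.aemeasurable
  have hjoint : P.map (fun ω => (T ω, U ω)) = (P.map T).prod (densityMeasure p₀) := by
    rw [(indepFun_iff_map_prod_eq_prod_map_map hT.aemeasurable hU.aemeasurable).mp hUT, hlaw]
  have hTU : Measurable fun ω => (T ω, U ω) := hT.prodMk hU
  have hlin : Measurable fun z : ℝ × ℝ => b * z.2 + z.1 := by fun_prop
  have hm1 : Measurable fun z : ℝ × ℝ => f (b * z.2 + z.1) := hf.continuous.measurable.comp hlin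
  have hm2 : Measurable fun z : ℝ × ℝ => deriv f (b * z.2 + z.1) :=
    (measurable_deriv f).comp hlin
  have hm3 : Measurable fun z : ℝ × ℝ => f (b * z.2 + z.1) * score p₀ z.2 :=
    hm1.mul ((measurable_score p₀ hp.differentiable.continuous.measurable).comp measurable_snd)
  have j1 : Integrable (fun z : ℝ × ℝ => f (b * z.2 + z.1))
      ((P.map T).prod (densityMeasure p₀)) := by
    rw [← hjoint, integrable_map_measure hm1.aestronglyMeasurable hTU.aemeasurable]; exact hi
  have j2 : Integrable (fun z : ℝ × ℝ => deriv f (b * z.2 + z.1))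
      ((P.map T).prod (densityMeasure p₀)) := by
    rw [← hjoint, integrable_map_measure hm2.aestronglyMeasurable hTU.aemeasurable]; exact hi'
  have j3 : Integrable (fun z : ℝ × ℝ => f (b * z.2 + z.1) * score p₀ z.2)
      ((P.map T).prod (densityMeasure p₀)) := by
    rw [← hjoint, integrable_map_measure hm3.aestronglyMeasurable hTU.aemeasurable]; exact his
  have e3 : ∫ ω, f (b * U ω + T ω) * score p₀ (U ω) ∂P
      = ∫ z, f (b * z.2 + z.1) * score p₀ z.2 ∂((P.map T).prod (densityMeasure p₀)) := by
    rw [← hjoint, integral_map hTU.aemeasurable hm3.aestronglyMeasurable]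
  have e2 : ∫ ω, deriv f (b * U ω + T ω) ∂P
      = ∫ z, deriv f (b * z.2 + z.1) ∂((P.map T).prod (densityMeasure p₀)) := by
    rw [← hjoint, integral_map hTU.aemeasurable hm2.aestronglyMeasurable]
  rw [e3, e2, integral_prod _ j3, integral_prod _ j2, ← integral_const_mul]
  refine integral_congr_ae ?_
  -- For almost every value t of T the integrability conditions hold in the variable u alone, and
  -- the one-dimensional identity applies to u ↦ f(bu + t).
  filter_upwards [j1.prod_right_ae, j2.prod_right_ae, j3.prod_right_ae] with t h1 h2 h3
  have hd : ∀ u, HasDerivAt (fun u => f (b * u + t)) (b * deriv f (b * u + t)) u := fun u => by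
    have h := (hf (b * u + t)).hasDerivAt.comp u
      (((hasDerivAt_id u).const_mul b).add_const t)
    refine h.congr_deriv ?_
    ring
  have hder : deriv (fun u => f (b * u + t)) = fun u => b * deriv f (b * u + t) :=
    funext fun u => (hd u).deriv
  have := integral_mul_score hp (fun u => (hd u).differentiableAt) h1
    (by rw [hder]; exact h2.const_mul b) h3
  rw [hder, integral_const_mul] at this
  exact this

/-- By Fubini, (u + v)² is integrable in u for almost every value v of V. One such v suffices, since
u² ≤ 2(u + v)² + 2v². This gives the signal a second moment when moments are assumed for the
response only. -/
theorem integrable_sq_of_indepFun_add {U V : Ω → ℝ} (hU : Measurable U) (hV : Measurable V)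
    (hUV : IndepFun V U P) (h : Integrable (fun ω => (U ω + V ω) ^ 2) P) :
    Integrable (fun ω => U ω ^ 2) P := by
  have : IsProbabilityMeasure (P.map U) := Measure.isProbabilityMeasure_map hU.aemeasurable
  have : IsProbabilityMeasure (P.map V) := Measure.isProbabilityMeasure_map hV.aemeasurable
  have hjoint := (indepFun_iff_map_prod_eq_prod_map_map hV.aemeasurable hU.aemeasurable).mp hUV
  have hm : Measurable fun z : ℝ × ℝ => (z.2 + z.1) ^ 2 := by fun_prop
  have j : Integrable (fun z : ℝ × ℝ => (z.2 + z.1) ^ 2) ((P.map V).prod (P.map U)) := by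
    rw [← hjoint, integrable_map_measure hm.aestronglyMeasurable (hV.prodMk hU).aemeasurable]
    exact h
  obtain ⟨v, hv⟩ := j.prod_right_ae.exists
  have h2 : Integrable (fun u : ℝ => u ^ 2) (P.map U) := by
    refine ((hv.const_mul 2).add (integrable_const (2 * v ^ 2))).mono
      (by fun_prop) (Filter.Eventually.of_forall fun u => ?_)
    simp only [Pi.add_apply]
    rw [Real.norm_of_nonneg (sq_nonneg _), Real.norm_of_nonneg (by positivity)]
    nlinarith [sq_nonneg (u + 2 * v)]
  rwa [integrable_map_measure (by fun_prop) hU.aemeasurable] at h2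

end Stein

/-! ### Moments of linear combinations of independent variables -/

section Moments

variable {Ω : Type*} [MeasurableSpace Ω] {P : Measure Ω} [IsProbabilityMeasure P]

theorem integrable_pow_of_pow_four {Z : Ω → ℝ} (hm : Measurable Z)
    (h : Integrable (fun ω => Z ω ^ 4) P) {k : ℕ} (hk : k ≤ 4) :
    Integrable (fun ω => Z ω ^ k) P := by
  refine ((integrable_const (1 : ℝ)).add h).mono (hm.pow_const k).aestronglyMeasurable
    (Filter.Eventually.of_forall fun ω => ?_)
  have h4 : 0 ≤ Z ω ^ 4 := by positivity
  simp only [Pi.add_apply]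
  rw [Real.norm_of_nonneg (by positivity : 0 ≤ 1 + Z ω ^ 4), norm_pow, Real.norm_eq_abs]
  rcases le_total |Z ω| 1 with h1 | h1
  · exact (pow_le_one₀ (abs_nonneg _) h1).trans (by linarith)
  · refine (pow_le_pow_right₀ h1 hk).trans ?_
    rw [← abs_pow, abs_of_nonneg h4]
    linarith

/-- Integrate 2cz² ≤ z⁴ + c². -/
theorem integral_sq_le_of_pow_four {Z : Ω → ℝ} (hm : Measurable Z)
    (h : Integrable (fun ω => Z ω ^ 4) P) {c : ℝ} (hc : 0 < c) (hM : ∫ ω, Z ω ^ 4 ∂P ≤ c ^ 2) :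
    ∫ ω, Z ω ^ 2 ∂P ≤ c := by
  have h2 := integrable_pow_of_pow_four hm h (k := 2) (by norm_num)
  have hle : ∫ ω, 2 * c * Z ω ^ 2 ∂P ≤ ∫ ω, (Z ω ^ 4 + c ^ 2) ∂P :=
    integral_mono (h2.const_mul _) (h.add (integrable_const _)) fun ω => by
      nlinarith [sq_nonneg (Z ω ^ 2 - c)]
  rw [integral_const_mul, integral_add h (integrable_const _)] at hle
  simp only [integral_const, probReal_univ, one_smul] at hle
  have : 2 * c * ∫ ω, Z ω ^ 2 ∂P ≤ 2 * c * c := by nlinarith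
  exact le_of_mul_le_mul_left this (by positivity)

theorem integrable_add_pow_four {T Z : Ω → ℝ} (hTm : Measurable T) (hZm : Measurable Z)
    (hT : Integrable (fun ω => T ω ^ 4) P) (hZ : Integrable (fun ω => Z ω ^ 4) P) :
    Integrable (fun ω => (T ω + Z ω) ^ 4) P := by
  refine ((hT.const_mul 8).add (hZ.const_mul 8)).mono
    ((hTm.add hZm).pow_const 4).aestronglyMeasurable (Filter.Eventually.of_forall fun ω => ?_)
  simp only [Pi.add_apply]
  rw [Real.norm_of_nonneg (by positivity), Real.norm_of_nonneg (by positivity)]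
  nlinarith [sq_nonneg (T ω - Z ω), sq_nonneg (T ω ^ 2 - Z ω ^ 2),
    sq_nonneg (T ω * (T ω - Z ω)), sq_nonneg (Z ω * (T ω - Z ω)),
    sq_nonneg ((T ω - Z ω) ^ 2), sq_nonneg ((T ω - Z ω) * (T ω + Z ω))]

/-- Second and fourth moments of the sum of two independent centered variables. -/
theorem integral_add_pow_of_indepFun {T Z : Ω → ℝ} (hTm : Measurable T) (hZm : Measurable Z)
    (hind : IndepFun T Z P) (hT : Integrable (fun ω => T ω ^ 4) P)
    (hZ : Integrable (fun ω => Z ω ^ 4) P) (hT0 : ∫ ω, T ω ∂P = 0) (hZ0 : ∫ ω, Z ω ∂P = 0) :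
    ∫ ω, (T ω + Z ω) ^ 2 ∂P = ∫ ω, T ω ^ 2 ∂P + ∫ ω, Z ω ^ 2 ∂P ∧
    ∫ ω, (T ω + Z ω) ^ 4 ∂P = ∫ ω, T ω ^ 4 ∂P
      + 6 * ((∫ ω, T ω ^ 2 ∂P) * ∫ ω, Z ω ^ 2 ∂P) + ∫ ω, Z ω ^ 4 ∂P := by
  have iT : ∀ k, k ≤ 4 → Integrable (fun ω => T ω ^ k) P :=
    fun k hk => integrable_pow_of_pow_four hTm hT hk
  have iZ : ∀ k, k ≤ 4 → Integrable (fun ω => Z ω ^ k) P :=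
    fun k hk => integrable_pow_of_pow_four hZm hZ hk
  have ind : ∀ k l : ℕ, IndepFun (fun ω => T ω ^ k) (fun ω => Z ω ^ l) P := fun k l =>
    hind.comp (measurable_id.pow_const k) (measurable_id.pow_const l)
  have ip : ∀ k l : ℕ, k ≤ 4 → l ≤ 4 → Integrable (fun ω => T ω ^ k * Z ω ^ l) P :=
    fun k l hk hl => (ind k l).integrable_mul (iT k hk) (iZ l hl)
  have ep : ∀ k l : ℕ, k ≤ 4 → l ≤ 4 →
      ∫ ω, T ω ^ k * Z ω ^ l ∂P = (∫ ω, T ω ^ k ∂P) * ∫ ω, Z ω ^ l ∂P := fun k l hk hl =>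
    (ind k l).integral_fun_mul_eq_mul_integral (iT k hk).aestronglyMeasurable
      (iZ l hl).aestronglyMeasurable
  have hT1 : ∫ ω, T ω ^ 1 ∂P = 0 := by simpa using hT0
  have hZ1 : ∫ ω, Z ω ^ 1 ∂P = 0 := by simpa using hZ0
  constructor
  · have e : ∀ ω, (T ω + Z ω) ^ 2 = T ω ^ 2 + Z ω ^ 2 + 2 * (T ω ^ 1 * Z ω ^ 1) := fun ω => by ring
    simp only [e]
    rw [integral_add ((iT 2 (by norm_num)).fun_add (iZ 2 (by norm_num)))
      ((ip 1 1 (by norm_num) (by norm_num)).const_mul 2),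
      integral_add (iT 2 (by norm_num)) (iZ 2 (by norm_num)), integral_const_mul,
      ep 1 1 (by norm_num) (by norm_num), hT1]
    ring
  · have e : ∀ ω, (T ω + Z ω) ^ 4 = T ω ^ 4 + 6 * (T ω ^ 2 * Z ω ^ 2) + Z ω ^ 4
        + 4 * (T ω ^ 3 * Z ω ^ 1) + 4 * (T ω ^ 1 * Z ω ^ 3) := fun ω => by ring
    simp only [e]
    have i22 := (ip 2 2 (by norm_num) (by norm_num)).const_mul 6
    have i31 := (ip 3 1 (by norm_num) (by norm_num)).const_mul 4
    have i13 := (ip 1 3 (by norm_num) (by norm_num)).const_mul 4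
    rw [integral_add (((hT.fun_add i22).fun_add hZ).fun_add i31) i13,
      integral_add ((hT.fun_add i22).fun_add hZ) i31, integral_add (hT.fun_add i22) hZ, integral_add hT i22,
      integral_const_mul, integral_const_mul, integral_const_mul,
      ep 2 2 (by norm_num) (by norm_num), ep 3 1 (by norm_num) (by norm_num),
      ep 1 3 (by norm_num) (by norm_num), hT1, hZ1]
    ring

/-- Add one variable at a time; odd cross terms vanish by centring. If q is the sum of squares so
far and w the new square, the fourth moment grows by at most 6c²qw + c²w², which fits into 3c²(q +
w)² - 3c²q². The second moment is carried along for the mixed term. -/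
theorem moments_linearCombination {ι : Type*} {Z : ι → Ω → ℝ} (hZm : ∀ i, Measurable (Z i))
    (hind : iIndepFun Z P) (hZ : ∀ i, Integrable (fun ω => Z i ω ^ 4) P)
    (hZ0 : ∀ i, ∫ ω, Z i ω ∂P = 0) {c : ℝ} (hc : 0 < c)
    (hM : ∀ i, ∫ ω, Z i ω ^ 4 ∂P ≤ c ^ 2) (u : ι → ℝ) (s : Finset ι) :
    Integrable (fun ω => (∑ i ∈ s, u i * Z i ω) ^ 4) P ∧ ∫ ω, (∑ i ∈ s, u i * Z i ω) ∂P = 0 ∧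
      ∫ ω, (∑ i ∈ s, u i * Z i ω) ^ 2 ∂P ≤ c * ∑ i ∈ s, u i ^ 2 ∧
      ∫ ω, (∑ i ∈ s, u i * Z i ω) ^ 4 ∂P ≤ 3 * c ^ 2 * (∑ i ∈ s, u i ^ 2) ^ 2 := by
  classical
  have hmeas : ∀ s : Finset ι, Measurable fun ω => ∑ i ∈ s, u i * Z i ω := fun s =>
    Finset.measurable_fun_sum _ fun i _ => (hZm i).const_mul (u i)
  induction s using Finset.induction_on with
  | empty => simp
  | insert i s hi ih =>
    obtain ⟨ih4, ih0, ih2, ihle⟩ := ih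
    have hind' : IndepFun (fun ω => ∑ j ∈ s, u j * Z j ω) (fun ω => u i * Z i ω) P := by
      have hcomp : iIndepFun (fun j ω => u j * Z j ω) P :=
        hind.comp (fun j x => u j * x) fun j => measurable_const_mul (u j)
      have := hcomp.indepFun_finsetSum_of_notMem (fun j => (hZm j).const_mul (u j)) hi
      convert this using 1
      ext ω
      simp
    have hW4 : Integrable (fun ω => (u i * Z i ω) ^ 4) P := by
      simp only [mul_pow]; exact (hZ i).const_mul _
    have hW0 : ∫ ω, u i * Z i ω ∂P = 0 := by rw [integral_const_mul, hZ0, mul_zero]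
    obtain ⟨e2, e4⟩ := integral_add_pow_of_indepFun (hmeas s) ((hZm i).const_mul (u i)) hind' ih4
      hW4 ih0 hW0
    have hW2 : ∫ ω, (u i * Z i ω) ^ 2 ∂P ≤ c * u i ^ 2 := by
      simp only [mul_pow]
      rw [integral_const_mul, mul_comm]
      exact mul_le_mul_of_nonneg_right
        (integral_sq_le_of_pow_four (hZm i) (hZ i) hc (hM i)) (sq_nonneg _)
    have hW4' : ∫ ω, (u i * Z i ω) ^ 4 ∂P ≤ c ^ 2 * (u i ^ 2) ^ 2 := by
      simp only [mul_pow]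
      rw [integral_const_mul, mul_comm, ← pow_mul]
      exact mul_le_mul_of_nonneg_right (hM i) (by positivity)
    have hi1 : Integrable (fun ω => ∑ j ∈ s, u j * Z j ω) P := by
      simpa using integrable_pow_of_pow_four (hmeas s) ih4 (k := 1) (by norm_num)
    have hi2 : Integrable (fun ω => u i * Z i ω) P := by
      simpa using integrable_pow_of_pow_four ((hZm i).const_mul (u i)) hW4 (k := 1) (by norm_num)
    have hsum : ∀ ω, ∑ j ∈ insert i s, u j * Z j ω = ∑ j ∈ s, u j * Z j ω + u i * Z i ω :=
      fun ω => by rw [Finset.sum_insert hi, add_comm]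
    simp only [hsum, Finset.sum_insert hi]
    refine ⟨integrable_add_pow_four (hmeas s) ((hZm i).const_mul _) ih4 hW4, ?_, ?_, ?_⟩
    · rw [integral_add hi1 hi2, ih0, hW0, add_zero]
    · rw [e2]; linarith
    · rw [e4]
      have hs : 0 ≤ ∑ j ∈ s, u j ^ 2 := Finset.sum_nonneg fun _ _ => sq_nonneg _
      have h22 : (∫ ω, (∑ j ∈ s, u j * Z j ω) ^ 2 ∂P) * ∫ ω, (u i * Z i ω) ^ 2 ∂P
          ≤ (c * ∑ j ∈ s, u j ^ 2) * (c * u i ^ 2) :=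
        mul_le_mul ih2 hW2 (integral_nonneg fun ω => sq_nonneg _) (by positivity)
      have : 0 ≤ c ^ 2 * (u i ^ 2) ^ 2 := by positivity
      nlinarith

/-- A weighted second moment of a linear combination of independent variables. -/
theorem integral_sq_mul_linearCombination_le {ι : Type*} [Fintype ι] {Z : ι → Ω → ℝ}
    (hZm : ∀ i, Measurable (Z i)) (hind : iIndepFun Z P)
    (hZ : ∀ i, Integrable (fun ω => Z i ω ^ 4) P) (hZ0 : ∀ i, ∫ ω, Z i ω ∂P = 0) {M : ℝ}
    (hM0 : 0 < M) (hM : ∀ i, ∫ ω, Z i ω ^ 4 ∂P ≤ M) {Y : Ω → ℝ}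
    (hY : Integrable (fun ω => Y ω ^ 4) P) (hYM : ∫ ω, Y ω ^ 4 ∂P ≤ M) (u : ι → ℝ) :
    ∫ ω, (Y ω * ∑ i, u i * Z i ω) ^ 2 ∂P ≤ 2 * M * ∑ i, u i ^ 2 := by
  have hsq : √M ^ 2 = M := Real.sq_sqrt hM0.le
  obtain ⟨h4, -, -, hle⟩ := moments_linearCombination hZm hind hZ hZ0 (Real.sqrt_pos.mpr hM0)
    (fun i => by rw [hsq]; exact hM i) u Finset.univ
  rw [hsq] at hle
  rcases (Finset.sum_nonneg fun i (_ : i ∈ Finset.univ) => sq_nonneg (u i)).eq_or_lt with h | h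
  · have hu : ∀ i, u i = 0 := fun i => by
      have := (Finset.sum_eq_zero_iff_of_nonneg fun i _ => sq_nonneg (u i)).mp h.symm i
        (Finset.mem_univ i)
      exact pow_eq_zero_iff (two_ne_zero) |>.mp this
    simp [hu]
  · set q := ∑ i, u i ^ 2
    have hmS : Measurable fun ω => ∑ i, u i * Z i ω :=
      Finset.measurable_fun_sum _ fun i _ => (hZm i).const_mul (u i)
    -- The weight q balances the two fourth moments, of orders M and 3Mq²: the result is Mq +
    -- (3/4)Mq, below 2Mq.
    have hpt : ∀ ω, (Y ω * ∑ i, u i * Z i ω) ^ 2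
        ≤ q * Y ω ^ 4 + (4 * q)⁻¹ * (∑ i, u i * Z i ω) ^ 4 := fun ω => by
      set T := ∑ i, u i * Z i ω
      have hq : q * (4 * q)⁻¹ = 1 / 4 := by field_simp
      have : 0 ≤ (4 * q)⁻¹ * (2 * q * Y ω ^ 2 - T ^ 2) ^ 2 := by positivity
      have e : (4 * q)⁻¹ * (2 * q * Y ω ^ 2 - T ^ 2) ^ 2
          = q * Y ω ^ 4 + (4 * q)⁻¹ * T ^ 4 - (Y ω * T) ^ 2 := by
        field_simp
        ring
      linarith
    have hI := (hY.const_mul q).add (h4.const_mul (4 * q)⁻¹)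
    refine (integral_mono_of_nonneg (Filter.Eventually.of_forall fun ω => sq_nonneg _) hI
      (Filter.Eventually.of_forall hpt)).trans ?_
    simp only [Pi.add_apply]
    rw [integral_add (hY.const_mul q) (h4.const_mul _), integral_const_mul, integral_const_mul]
    have h1 := mul_le_mul_of_nonneg_left hYM h.le
    have h2 := mul_le_mul_of_nonneg_left hle (show 0 ≤ (4 * q)⁻¹ by positivity)
    have e : (4 * q)⁻¹ * (3 * M * q ^ 2) = 3 / 4 * M * q := by
      field_simp
    have : 0 < M * q := by positivity
    rw [e] at h2
    linarith

end Moments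

/-! ### Concentration of sums of spectrally truncated matrices -/

/-- Truncation of a real number to `[-1, 1]`. -/
noncomputable def clip (x : ℝ) : ℝ := max (-1) (min 1 x)

theorem continuous_clip : Continuous clip :=
  continuous_const.max (continuous_const.min continuous_id)

theorem abs_clip_le_one (x : ℝ) : |clip x| ≤ 1 :=
  abs_le.mpr ⟨le_max_left _ _, max_le (by norm_num) (min_le_left _ _)⟩

theorem clip_of_abs_le {x : ℝ} (h : |x| ≤ 1) : clip x = x := by
  rw [clip, min_eq_right (abs_le.mp h).2, max_eq_right (abs_le.mp h).1]

theorem clip_of_one_le {x : ℝ} (h : 1 ≤ x) : clip x = 1 := by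
  rw [clip, min_eq_left h, max_eq_right (by norm_num)]

theorem clip_of_le_neg_one {x : ℝ} (h : x ≤ -1) : clip x = -1 := by
  rw [clip, min_eq_right (by linarith), max_eq_left h]

theorem clip_neg (x : ℝ) : clip (-x) = -clip x := by
  rcases le_total |x| 1 with h | h
  · rw [clip_of_abs_le h, clip_of_abs_le (by rwa [abs_neg])]
  · rcases le_abs.mp h with h | h
    · rw [clip_of_one_le h, clip_of_le_neg_one (by linarith)]
    · rw [clip_of_one_le h, clip_of_le_neg_one (x := x) (by linarith), neg_neg]

theorem abs_clip_sub_le (x : ℝ) : |clip x - x| ≤ x ^ 2 := by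
  rcases le_total |x| 1 with h | h
  · rw [clip_of_abs_le h, sub_self, abs_zero]; positivity
  · rcases le_abs.mp h with h | h
    · rw [clip_of_one_le h, abs_le]; constructor <;> nlinarith
    · rw [clip_of_le_neg_one (by linarith), abs_le]; constructor <;> nlinarith

theorem clip_sq_le (x : ℝ) : clip x ^ 2 ≤ x ^ 2 := by
  rcases le_total |x| 1 with h | h
  · rw [clip_of_abs_le h]
  · rcases le_abs.mp h with h | h
    · rw [clip_of_one_le h]; nlinarith
    · rw [clip_of_le_neg_one (by linarith)]; nlinarith

/-- After exponentiation the claim is 1 + x + x²/2 ≤ e^{clip x}(1 + 2x²). The exponential is at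
least 1/3 everywhere, which settles x ≤ -3/4; it is at least 1 + x up to x = 1, and at least 2
beyond. -/
theorem log_le_clip_add (x : ℝ) :
    Real.log (1 + x + x ^ 2 / 2) ≤ clip x + Real.log (1 + 2 * x ^ 2) := by
  have hpos : 0 < 1 + x + x ^ 2 / 2 := by nlinarith [sq_nonneg (x + 1)]
  have hpos' : 0 < 1 + 2 * x ^ 2 := by positivity
  rw [Real.log_le_iff_le_exp hpos, Real.exp_add, Real.exp_log hpos']
  rcases le_or_gt x (-3 / 4) with h | h
  · have h1 : (1 : ℝ) / 3 ≤ Real.exp (clip x) := by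
      refine le_trans ?_ (Real.exp_le_exp.mpr (abs_le.mp (abs_clip_le_one x)).1)
      rw [Real.exp_neg, one_div]
      exact inv_anti₀ (Real.exp_pos 1) (by linarith [Real.exp_one_lt_d9])
    have := mul_le_mul_of_nonneg_right h1 hpos'.le
    nlinarith
  · rcases le_total x 1 with h2 | h2
    · rw [clip_of_abs_le (abs_le.mpr ⟨by linarith, h2⟩)]
      have := mul_le_mul_of_nonneg_right (Real.add_one_le_exp x) hpos'.le
      nlinarith [mul_nonneg (sq_nonneg x) (show 0 ≤ x + 3 / 4 by linarith)]
    · rw [clip_of_one_le h2]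
      have := mul_le_mul_of_nonneg_right (Real.add_one_le_exp 1) hpos'.le
      nlinarith

theorem IsInfluenceFunction.le_clip_add {φ : ℝ → ℝ} (h : IsInfluenceFunction φ) (x : ℝ) :
    φ x ≤ clip x + Real.log (1 + 2 * x ^ 2) := (h.upper x).trans (log_le_clip_add x)

/-- The lower envelope of φ is the upper one reflected through the origin, and `clip` is odd. The
factor `-1 *` is the shape that `smul_cfc` expects. -/
theorem IsInfluenceFunction.clip_sub_le {φ : ℝ → ℝ} (h : IsInfluenceFunction φ) (x : ℝ) :
    clip x + -1 * Real.log (1 + 2 * x ^ 2) ≤ φ x := by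
  have h1 := log_le_clip_add (-x)
  rw [clip_neg, neg_sq] at h1
  have h2 := h.lower x
  rw [← sub_eq_add_neg] at h1
  linarith

/-! ### Quadratic and bilinear forms of symmetric matrices -/

section Quadratic

variable {N : Type*} [Fintype N]

theorem dotProduct_mulVec_comm_of_isHermitian {H : Matrix N N ℝ} (hH : H.IsHermitian)
    (u v : N → ℝ) : v ⬝ᵥ H *ᵥ u = u ⬝ᵥ H *ᵥ v := by
  have hT : Hᵀ = H := by rw [← Matrix.conjTranspose_eq_transpose_of_trivial]; exact hH
  rw [Matrix.dotProduct_mulVec, dotProduct_comm, ← Matrix.mulVec_transpose, hT]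

/-- A bound on a quadratic form bounds the associated bilinear form. -/
theorem dotProduct_mulVec_le_of_quadratic {H : Matrix N N ℝ} (hH : H.IsHermitian) {t : ℝ}
    (h : ∀ x : N → ℝ, |x ⬝ᵥ H *ᵥ x| ≤ t * (x ⬝ᵥ x)) (u v : N → ℝ) :
    u ⬝ᵥ H *ᵥ v ≤ t * (u ⬝ᵥ u + v ⬝ᵥ v) / 2 := by
  have h1 := (abs_le.mp (h (u + v))).2
  have h2 := (abs_le.mp (h (u - v))).1
  simp only [Matrix.mulVec_add, Matrix.mulVec_sub, add_dotProduct, sub_dotProduct, dotProduct_add,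
    dotProduct_sub, dotProduct_mulVec_comm_of_isHermitian hH u v, dotProduct_comm v u] at h1 h2
  linarith

variable [DecidableEq N]

theorem single_dotProduct_mulVec_single (H : Matrix N N ℝ) (a b : N) :
    (Pi.single a 1 : N → ℝ) ⬝ᵥ H *ᵥ Pi.single b 1 = H a b := by
  simp

theorem abs_apply_le_of_quadratic {H : Matrix N N ℝ} (hH : H.IsHermitian)
    (h : ∀ x : N → ℝ, |x ⬝ᵥ H *ᵥ x| ≤ x ⬝ᵥ x) (a b : N) : |H a b| ≤ 1 := by
  have h' : ∀ x : N → ℝ, |x ⬝ᵥ H *ᵥ x| ≤ 1 * (x ⬝ᵥ x) := fun x => by rw [one_mul]; exact h x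
  have h1 := dotProduct_mulVec_le_of_quadratic hH h' (Pi.single a 1) (Pi.single b 1)
  have h2 := dotProduct_mulVec_le_of_quadratic hH h' (-Pi.single a 1) (Pi.single b 1)
  rw [neg_dotProduct] at h2
  rw [single_dotProduct_mulVec_single] at h1 h2
  simp only [neg_dotProduct, dotProduct_neg, single_one_dotProduct, Pi.single_eq_same] at h1 h2
  exact abs_le.mpr ⟨by linarith, by linarith⟩

end Quadratic

section Concentration

variable {Ω : Type*} [MeasurableSpace Ω] {P : Measure Ω} [IsProbabilityMeasure P]
  {N : Type*} [Fintype N] [DecidableEq N] {E : Type*} [MeasurableSpace E]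

/-- The entries of the exponential are bounded by its trace, and that trace by the trace of the
dominating matrix M. -/
theorem integrable_exp_apply {Z M : Ω → Matrix N N ℝ} (hZ : ∀ ω, (Z ω).IsHermitian)
    (hZm : ∀ a b, Measurable fun ω => Z ω a b) (hM : ∀ a b, Integrable (fun ω => M ω a b) P)
    (h : ∀ ω (x : N → ℝ), x ⬝ᵥ NormedSpace.exp (Z ω) *ᵥ x ≤ x ⬝ᵥ M ω *ᵥ x) (a b : N) :
    Integrable (fun ω => NormedSpace.exp (Z ω) a b) P := by
  have hI : Integrable (fun ω => ∑ a, M ω a a) P := integrable_finsetSum _ fun a _ => hM a a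
  refine hI.mono (measurable_exp_apply hZ hZm a b).aestronglyMeasurable
    (Filter.Eventually.of_forall fun ω => ?_)
  have hle : (NormedSpace.exp (Z ω)).trace ≤ ∑ a, M ω a a := Finset.sum_le_sum fun a _ => by
    have := h ω (Pi.single a 1)
    rwa [single_dotProduct_mulVec_single, single_dotProduct_mulVec_single] at this
  rw [Real.norm_of_nonneg ((trace_exp_nonneg (hZ ω)).trans hle)]
  exact (abs_apply_le_trace_of_posSemidef (posSemidef_exp (hZ ω)) a b).trans hle

variable {n : ℕ} {W : Fin n → Ω → E} {V : Ω → E}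

/-- The Ahlswede–Winter bound in terms of one copy V, with the exponential replaced by a dominating
matrix M whose mean is computable. -/
theorem measure_not_sum_le_of_identDistrib (hW : ∀ i, Measurable (W i))
    (hind : iIndepFun W P) (hid : ∀ i, IdentDistrib (W i) V P P) {g M : E → Matrix N N ℝ}
    (hg : ∀ e, (g e).IsHermitian) (hgm : ∀ a b, Measurable fun e => g e a b)
    (hV : Measurable V) (hM : ∀ a b, Integrable (fun ω => M (V ω) a b) P)
    (hle : ∀ e (x : N → ℝ), x ⬝ᵥ NormedSpace.exp (g e) *ᵥ x ≤ x ⬝ᵥ M e *ᵥ x) {v : ℝ}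
    (hv0 : 0 ≤ v) (hv : ∀ x : N → ℝ, ∫ ω, x ⬝ᵥ M (V ω) *ᵥ x ∂P ≤ v * (x ⬝ᵥ x)) (s : ℝ) :
    P {ω | ¬ ∀ x : N → ℝ, x ⬝ᵥ (∑ i, g (W i ω)) *ᵥ x ≤ s * (x ⬝ᵥ x)}
      ≤ ENNReal.ofReal (Fintype.card N * v ^ n * Real.exp (-s)) := by
  have hexp : ∀ a b, Integrable (fun ω => NormedSpace.exp (g (V ω)) a b) P :=
    integrable_exp_apply (fun ω => hg _) (fun a b => (hgm a b).comp hV) hM fun ω x => hle _ x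
  have hm := measurable_exp_apply hg hgm
  have hexpW : ∀ i a b, Integrable (fun ω => NormedSpace.exp (g (W i ω)) a b) P := fun i a b =>
    ((hid i).comp (hm a b)).integrable_iff.mpr (hexp a b)
  have h := measure_not_sum_le hW hind hg hgm hexpW hv0 (fun i x => ?_) s
  · rwa [Fintype.card_fin] at h
  · have hq : Measurable fun e => x ⬝ᵥ NormedSpace.exp (g e) *ᵥ x := by
      simp only [dotProduct_mulVec_eq_sum]
      exact Finset.measurable_fun_sum _ fun a _ => Finset.measurable_fun_sum _ fun b _ =>
        (hm a b).const_mul _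
    have e := ((hid i).comp hq).integral_eq
    simp only [Function.comp_apply] at e
    rw [e]
    exact (integral_mono (integrable_dotProduct_mulVec hexp x) (integrable_dotProduct_mulVec hM x)
      fun ω => hle _ x).trans (hv x)

/-- A Bernstein-type bound for sums of independent copies of a bounded random matrix. -/
theorem measure_not_sum_sub_mean_le (hW : ∀ i, Measurable (W i))
    (hind : iIndepFun W P) (hid : ∀ i, IdentDistrib (W i) V P P) (hV : Measurable V)
    {G : E → Matrix N N ℝ} (hG : ∀ e, (G e).IsHermitian)
    (hGm : ∀ a b, Measurable fun e => G e a b)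
    (hbd : ∀ e (x : N → ℝ), |x ⬝ᵥ G e *ᵥ x| ≤ x ⬝ᵥ x) {η : ℝ} (hη : 0 ≤ η)
    (hsq : ∀ x : N → ℝ, ∫ ω, x ⬝ᵥ (G (V ω) * G (V ω)) *ᵥ x ∂P ≤ η * (x ⬝ᵥ x)) (s : ℝ) :
    P {ω | ¬ ∀ x : N → ℝ, x ⬝ᵥ (∑ i, G (W i ω)) *ᵥ x
        ≤ n * (x ⬝ᵥ meanMatrix P (fun ω => G (V ω)) *ᵥ x) + s * (x ⬝ᵥ x)}
      ≤ ENNReal.ofReal (Fintype.card N * (1 + 2 * η) ^ n * Real.exp (-s)) := by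
  set D := meanMatrix P (fun ω => G (V ω)) with hD
  have hent : ∀ e a b, |G e a b| ≤ 1 := fun e => abs_apply_le_of_quadratic (hG e) (hbd e)
  have hGi : ∀ a b, Integrable (fun ω => G (V ω) a b) P := fun a b =>
    Integrable.of_bound ((hGm a b).comp hV).aestronglyMeasurable 1
      (Filter.Eventually.of_forall fun ω => hent _ a b)
  have hDH : D.IsHermitian := isHermitian_meanMatrix fun ω => hG _
  have hDbd : ∀ x : N → ℝ, |x ⬝ᵥ D *ᵥ x| ≤ x ⬝ᵥ x := fun x => by
    rw [hD, dotProduct_meanMatrix_mulVec hGi]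
    refine abs_integral_le_integral_abs.trans ?_
    refine (integral_mono (integrable_dotProduct_mulVec hGi x).abs (integrable_const (x ⬝ᵥ x))
      fun ω => hbd _ x).trans ?_
    simp
  set Z : E → Matrix N N ℝ := fun e => G e - D with hZ
  have hZH : ∀ e, (Z e).IsHermitian := fun e => (hG e).sub hDH
  have hZm : ∀ a b, Measurable fun e => Z e a b := fun a b => (hGm a b).sub_const (D a b)
  have hZbd : ∀ e (x : N → ℝ), |x ⬝ᵥ Z e *ᵥ x| ≤ 2 * (x ⬝ᵥ x) := fun e x => by
    rw [hZ, Matrix.sub_mulVec, dotProduct_sub]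
    refine (abs_sub _ _).trans ?_
    linarith [hbd e x, hDbd x]
  have hZi : ∀ a b, Integrable (fun ω => Z (V ω) a b) P := fun a b =>
    (hGi a b).sub (integrable_const _)
  have hmul : ∀ F : E → Matrix N N ℝ, (∀ a b, Measurable fun e => F e a b) →
      (∀ e a b, |F e a b| ≤ 2) → ∀ a b, Integrable (fun ω => (F (V ω) * F (V ω)) a b) P :=
    fun F hF hb a b => by
      simp only [Matrix.mul_apply]
      refine integrable_finsetSum _ fun c _ => Integrable.of_bound
        (((hF a c).comp hV).mul ((hF c b).comp hV)).aestronglyMeasurable (2 * 2)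
        (Filter.Eventually.of_forall fun ω => ?_)
      rw [norm_mul]
      exact mul_le_mul (hb _ _ _) (hb _ _ _) (norm_nonneg _) (by norm_num)
  have hGG := hmul G hGm fun e a b => (hent e a b).trans (by norm_num)
  have hZZ := hmul Z hZm fun e a b => by
    have hDe := abs_apply_le_of_quadratic hDH hDbd a b
    have := abs_sub (G e a b) (D a b)
    simp only [hZ, Matrix.sub_apply]
    linarith [hent e a b]
  -- 1 + Z + 2Z² dominates exp Z because |Z| ≤ 2 as a form, and the linear term has mean zero.
  set M : E → Matrix N N ℝ := fun e => 1 + Z e + (2 : ℝ) • (Z e * Z e) with hMdef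
  have hMi : ∀ a b, Integrable (fun ω => M (V ω) a b) P := fun a b =>
    ((integrable_const _).add (hZi a b)).add ((hZZ a b).const_mul 2)
  have hMq : ∀ e (x : N → ℝ), x ⬝ᵥ M e *ᵥ x
      = x ⬝ᵥ x + x ⬝ᵥ Z e *ᵥ x + 2 * (x ⬝ᵥ (Z e * Z e) *ᵥ x) := fun e x => by
    simp only [hMdef, Matrix.add_mulVec, Matrix.smul_mulVec, Matrix.one_mulVec, dotProduct_add,
      dotProduct_smul, smul_eq_mul]
  have h := measure_not_sum_le_of_identDistrib (v := 1 + 2 * η) hW hind hid hZH hZm hV hMi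
    (fun e x => by rw [hMq]; exact dotProduct_exp_mulVec_le (hZH e) (hZbd e) x) (by positivity)
    (fun x => ?_) s
  · refine le_trans (measure_mono ?_) h
    intro ω hω
    rw [Set.mem_ofPred_eq] at hω ⊢
    refine fun hall => hω fun x => ?_
    have hx := hall x
    have e : ∑ i, Z (W i ω) = (∑ i, G (W i ω)) - (n : ℝ) • D := by
      rw [hZ, Finset.sum_sub_distrib, Finset.sum_const, Finset.card_univ, Fintype.card_fin,
        Nat.cast_smul_eq_nsmul]
    rw [e, Matrix.sub_mulVec, dotProduct_sub, Matrix.smul_mulVec, dotProduct_smul,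
      smul_eq_mul] at hx
    linarith
  · have hZ0 : ∫ ω, x ⬝ᵥ Z (V ω) *ᵥ x ∂P = 0 := by
      simp only [hZ, Matrix.sub_mulVec, dotProduct_sub]
      rw [integral_sub (integrable_dotProduct_mulVec hGi x) (integrable_const _),
        ← dotProduct_meanMatrix_mulVec hGi]
      simp [hD]
    have hGD : ∀ ω, x ⬝ᵥ (Z (V ω) * Z (V ω)) *ᵥ x
        = x ⬝ᵥ (G (V ω) * G (V ω)) *ᵥ x - 2 * ((D *ᵥ x) ⬝ᵥ G (V ω) *ᵥ x)
          + (D *ᵥ x) ⬝ᵥ (D *ᵥ x) := fun ω => by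
      have q : ∀ H : Matrix N N ℝ, H.IsHermitian →
          x ⬝ᵥ (H * H) *ᵥ x = (H *ᵥ x) ⬝ᵥ (H *ᵥ x) := fun H hH => by
        rw [dotProduct_mulVec_self, ← Matrix.conjTranspose_eq_transpose_of_trivial, hH.eq]
      rw [q _ (hZH _), q _ (hG _), hZ]
      simp only [Matrix.sub_mulVec, sub_dotProduct, dotProduct_sub,
        dotProduct_comm (G (V ω) *ᵥ x) (D *ᵥ x)]
      ring
    have hbil : Integrable (fun ω => (D *ᵥ x) ⬝ᵥ G (V ω) *ᵥ x) P ∧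
        ∫ ω, (D *ᵥ x) ⬝ᵥ G (V ω) *ᵥ x ∂P = (D *ᵥ x) ⬝ᵥ (D *ᵥ x) := by
      simp only [dotProduct, Matrix.mulVec]
      have hi : ∀ a, Integrable (fun ω => ∑ b, G (V ω) a b * x b) P := fun a =>
        integrable_finsetSum _ fun b _ => (hGi a b).mul_const _
      refine ⟨integrable_finsetSum _ fun a _ => (hi a).const_mul _, ?_⟩
      rw [integral_finsetSum _ fun a _ => (hi a).const_mul _]
      refine Finset.sum_congr rfl fun a _ => ?_
      rw [integral_const_mul, integral_finsetSum _ fun b _ => (hGi a b).mul_const _]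
      congr 1
      refine Finset.sum_congr rfl fun b _ => ?_
      rw [integral_mul_const]
      rfl
    -- Centring only lowers the second moment: 𝔼 Z² = 𝔼 G² - D².
    have hZsq : ∫ ω, x ⬝ᵥ (Z (V ω) * Z (V ω)) *ᵥ x ∂P ≤ η * (x ⬝ᵥ x) := by
      simp only [hGD]
      have i1 := integrable_dotProduct_mulVec hGG x
      have i2 : Integrable (fun ω => x ⬝ᵥ (G (V ω) * G (V ω)) *ᵥ x
          - 2 * ((D *ᵥ x) ⬝ᵥ G (V ω) *ᵥ x)) P := i1.sub (hbil.1.const_mul 2)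
      rw [integral_add i2 (integrable_const _),
        integral_sub i1 (hbil.1.const_mul 2), integral_const_mul, hbil.2]
      simp only [integral_const, probReal_univ, one_smul]
      have : 0 ≤ (D *ᵥ x) ⬝ᵥ (D *ᵥ x) := Finset.sum_nonneg fun i _ => mul_self_nonneg _
      linarith [hsq x]
    simp only [hMq]
    have i1 := integrable_dotProduct_mulVec hZi x
    have i2 := integrable_dotProduct_mulVec hZZ x
    rw [integral_add ((integrable_const _).fun_add i1) (i2.const_mul 2),
      integral_add (integrable_const _) i1, integral_const_mul, hZ0]
    simp only [integral_const, probReal_univ, one_smul]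
    linarith

/-- Concentration of the sum of the matrices `φ(K(Wᵢ))` around `n 𝔼 K`. -/
theorem measure_not_abs_sum_cfc_sub_le (hW : ∀ i, Measurable (W i))
    (hind : iIndepFun W P) (hid : ∀ i, IdentDistrib (W i) V P P) (hV : Measurable V)
    {K : E → Matrix N N ℝ} (hK : ∀ e, (K e).IsHermitian)
    (hKm : ∀ a b, Measurable fun e => K e a b)
    (hKi : ∀ a b, Integrable (fun ω => K (V ω) a b) P)
    (hKK : ∀ a b, Integrable (fun ω => (K (V ω) * K (V ω)) a b) P) {η : ℝ} (hη : 0 ≤ η)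
    (hsq : ∀ x : N → ℝ, ∫ ω, x ⬝ᵥ (K (V ω) * K (V ω)) *ᵥ x ∂P ≤ η * (x ⬝ᵥ x))
    {φ : ℝ → ℝ} (hφ : IsInfluenceFunction φ) (s : ℝ) :
    P {ω | ¬ ∀ x : N → ℝ, |x ⬝ᵥ ((∑ i, (hK (W i ω)).cfc φ)
        - (n : ℝ) • meanMatrix P (fun ω => K (V ω))) *ᵥ x| ≤ (n * η + 2 * s) * (x ⬝ᵥ x)}
      ≤ ENNReal.ofReal (3 * (Fintype.card N * (1 + 2 * η) ^ n * Real.exp (-s))) := by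
  set G : E → Matrix N N ℝ := fun e => (hK e).cfc clip with hGdef
  set R : E → Matrix N N ℝ := fun e => (hK e).cfc fun x => Real.log (1 + 2 * x ^ 2) with hRdef
  have hG : ∀ e, (G e).IsHermitian := fun e => cfc_isHermitian _ _
  have hR : ∀ e, (R e).IsHermitian := fun e => cfc_isHermitian _ _
  have hGm : ∀ a b, Measurable fun e => G e a b := measurable_cfc_apply hK hKm continuous_clip
  have hRm : ∀ a b, Measurable fun e => R e a b := measurable_cfc_apply hK hKm
    (Continuous.log (by fun_prop) fun x => by positivity)
  have hone : ∀ e (c : ℝ) (x : N → ℝ), x ⬝ᵥ (hK e).cfc (fun _ => c * 1) *ᵥ x = c * (x ⬝ᵥ x) :=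
    fun e c x => by
      rw [← smul_cfc, cfc_one_eq, Matrix.smul_mulVec, Matrix.one_mulVec, dotProduct_smul,
        smul_eq_mul]
  have hbd : ∀ e (x : N → ℝ), |x ⬝ᵥ G e *ᵥ x| ≤ x ⬝ᵥ x := fun e x => by
    have h1 := dotProduct_cfc_mulVec_mono (hK e) (g := fun _ => 1 * 1)
      (fun y => by simpa using (abs_le.mp (abs_clip_le_one y)).2) x
    have h2 := dotProduct_cfc_mulVec_mono (hK e) (f := fun _ => (-1) * 1)
      (fun y => by simpa using (abs_le.mp (abs_clip_le_one y)).1) x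
    rw [hone] at h1 h2
    exact abs_le.mpr ⟨by linarith, by linarith⟩
  have hGi : ∀ a b, Integrable (fun ω => G (V ω) a b) P := fun a b =>
    Integrable.of_bound ((hGm a b).comp hV).aestronglyMeasurable 1
      (Filter.Eventually.of_forall fun ω => abs_apply_le_of_quadratic (hG _) (hbd _) a b)
  have hGsq : ∀ e (x : N → ℝ), x ⬝ᵥ (G e * G e) *ᵥ x ≤ x ⬝ᵥ (K e * K e) *ᵥ x := fun e x => by
    rw [hGdef, cfc_mul_cfc, ← cfc_sq_eq (hK e)]
    refine dotProduct_cfc_mulVec_mono (hK e) (fun y => ?_) x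
    rw [← pow_two]
    exact clip_sq_le y
  have hGGnn : ∀ e (x : N → ℝ), 0 ≤ x ⬝ᵥ (G e * G e) *ᵥ x := fun e x => by
    have h := dotProduct_mulVec_self (G e) x
    rw [← Matrix.conjTranspose_eq_transpose_of_trivial, (hG e).eq] at h
    rw [← h]
    exact Finset.sum_nonneg fun i _ => mul_self_nonneg _
  have hsqG : ∀ x : N → ℝ, ∫ ω, x ⬝ᵥ (G (V ω) * G (V ω)) *ᵥ x ∂P ≤ η * (x ⬝ᵥ x) := fun x =>
    (integral_mono_of_nonneg (Filter.Eventually.of_forall fun ω => hGGnn _ x)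
      (integrable_dotProduct_mulVec hKK x)
      (Filter.Eventually.of_forall fun ω => hGsq _ x)).trans (hsq x)
  set D := meanMatrix P (fun ω => G (V ω)) with hD
  set B := meanMatrix P (fun ω => K (V ω)) with hB
  -- |clip y - y| ≤ y² in the functional calculus: the bias is paid for by the second moment.
  have hbias : ∀ x : N → ℝ, |x ⬝ᵥ D *ᵥ x - x ⬝ᵥ B *ᵥ x| ≤ η * (x ⬝ᵥ x) := fun x => by
    rw [hD, hB, dotProduct_meanMatrix_mulVec hGi, dotProduct_meanMatrix_mulVec hKi,
      ← integral_sub (integrable_dotProduct_mulVec hGi x) (integrable_dotProduct_mulVec hKi x)]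
    refine abs_integral_le_integral_abs.trans (le_trans ?_ (hsq x))
    refine integral_mono ((integrable_dotProduct_mulVec hGi x).sub
      (integrable_dotProduct_mulVec hKi x)).abs (integrable_dotProduct_mulVec hKK x) fun ω => ?_
    have hsub : ∀ c : ℝ, x ⬝ᵥ (hK (V ω)).cfc (fun y => clip y + c * y) *ᵥ x
        = x ⬝ᵥ G (V ω) *ᵥ x + c * (x ⬝ᵥ K (V ω) *ᵥ x) := fun c => by
      rw [← cfc_add_cfc, ← smul_cfc, cfc_id_eq, Matrix.add_mulVec, Matrix.smul_mulVec,
        dotProduct_add, dotProduct_smul, smul_eq_mul]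
    have h1 := dotProduct_cfc_mulVec_mono (hK (V ω)) (f := fun y => clip y + (-1) * y)
      (g := fun y => y ^ 2) (fun y => by linarith [(abs_le.mp (abs_clip_sub_le y)).2]) x
    have h2 := dotProduct_cfc_mulVec_mono (hK (V ω)) (f := fun y => (-1) * y ^ 2)
      (g := fun y => clip y + (-1) * y)
      (fun y => by linarith [(abs_le.mp (abs_clip_sub_le y)).1]) x
    rw [← smul_cfc, Matrix.smul_mulVec, dotProduct_smul, smul_eq_mul] at h2
    rw [hsub, cfc_sq_eq] at h1 h2
    simp only
    exact abs_le.mpr ⟨by linarith, by linarith⟩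
  have hRle : P {ω | ¬ ∀ x : N → ℝ, x ⬝ᵥ (∑ i, R (W i ω)) *ᵥ x ≤ s * (x ⬝ᵥ x)}
      ≤ ENNReal.ofReal (Fintype.card N * (1 + 2 * η) ^ n * Real.exp (-s)) := by
    have hMq : ∀ e (x : N → ℝ), x ⬝ᵥ (1 + (2 : ℝ) • (K e * K e)) *ᵥ x
        = x ⬝ᵥ x + 2 * (x ⬝ᵥ (K e * K e) *ᵥ x) := fun e x => by
      simp only [Matrix.add_mulVec, Matrix.smul_mulVec, Matrix.one_mulVec, dotProduct_add,
        dotProduct_smul, smul_eq_mul]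
    refine measure_not_sum_le_of_identDistrib (M := fun e => 1 + (2 : ℝ) • (K e * K e)) hW hind hid
      hR hRm hV (fun a b => (integrable_const _).add ((hKK a b).const_mul 2)) (fun e x => ?_)
      (by positivity) (fun x => ?_) s
    -- The exponential undoes the logarithm, so the Laplace transform of the remainder needs only 𝔼
    -- K².
    · have hexp : NormedSpace.exp (R e) = 1 + (2 : ℝ) • (K e * K e) := by
        rw [hRdef, exp_cfc, ← cfc_sq_eq (hK e), smul_cfc, ← cfc_one_eq (hK e), cfc_add_cfc]
        congr 1
        funext y
        exact Real.exp_log (by positivity)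
      rw [hexp]
    · simp only [hMq]
      rw [integral_add (integrable_const _) ((integrable_dotProduct_mulVec hKK x).const_mul 2),
        integral_const_mul]
      simp only [integral_const, probReal_univ, one_smul]
      linarith [hsq x]
  have hGle := measure_not_sum_sub_mean_le hW hind hid hV hG hGm hbd hη hsqG s
  have hGle' := measure_not_sum_sub_mean_le (G := fun e => -G e) hW hind hid hV
    (fun e => (hG e).neg) (fun a b => (hGm a b).neg)
    (fun e x => by rw [Matrix.neg_mulVec, dotProduct_neg, abs_neg]; exact hbd e x) hη
    (fun x => by simpa only [neg_mul_neg] using hsqG x) s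
  have hneg : meanMatrix P (fun ω => -G (V ω)) = -D := by
    ext a b
    exact integral_neg _
  rw [hneg] at hGle'
  set p := ENNReal.ofReal (Fintype.card N * (1 + 2 * η) ^ n * Real.exp (-s))
  have h3 : ENNReal.ofReal (3 * (Fintype.card N * (1 + 2 * η) ^ n * Real.exp (-s)))
      = p + p + p := by
    rw [← ENNReal.ofReal_add (by positivity) (by positivity),
      ← ENNReal.ofReal_add (by positivity) (by positivity)]
    congr 1
    ring
  rw [h3]
  -- Outside three events (the clipped sum too large, too small, the remainder too large) the
  -- deviation is at most s from clipping, s from the remainder and nη from the bias.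
  refine le_trans (measure_mono ?_) ((measure_union_le _ _).trans
    (add_le_add ((measure_union_le _ _).trans (add_le_add hGle hGle')) hRle))
  intro ω hω
  by_contra hcon
  simp only [Set.mem_union, Set.mem_ofPred_eq, not_or, not_not] at hcon
  obtain ⟨⟨c1, c2⟩, c3⟩ := hcon
  refine hω fun x => ?_
  have k1 := c1 x
  have k2 := c2 x
  have k3 := c3 x
  have kb := abs_le.mp (hbias x)
  simp only [Finset.sum_neg_distrib, Matrix.neg_mulVec, dotProduct_neg] at k2
  have hsum : ∀ F : Fin n → Matrix N N ℝ, x ⬝ᵥ (∑ i, F i) *ᵥ x = ∑ i, x ⬝ᵥ F i *ᵥ x := fun F => by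
    rw [Matrix.sum_mulVec, dotProduct_sum]
  have hup : x ⬝ᵥ (∑ i, (hK (W i ω)).cfc φ) *ᵥ x
      ≤ x ⬝ᵥ (∑ i, G (W i ω)) *ᵥ x + x ⬝ᵥ (∑ i, R (W i ω)) *ᵥ x := by
    rw [hsum, hsum, hsum, ← Finset.sum_add_distrib]
    refine Finset.sum_le_sum fun i _ => ?_
    have h := dotProduct_cfc_mulVec_mono (hK (W i ω)) hφ.le_clip_add x
    rwa [← cfc_add_cfc, Matrix.add_mulVec, dotProduct_add] at h
  have hlow : x ⬝ᵥ (∑ i, G (W i ω)) *ᵥ x - x ⬝ᵥ (∑ i, R (W i ω)) *ᵥ x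
      ≤ x ⬝ᵥ (∑ i, (hK (W i ω)).cfc φ) *ᵥ x := by
    rw [hsum, hsum, hsum, ← Finset.sum_sub_distrib]
    refine Finset.sum_le_sum fun i _ => ?_
    have h := dotProduct_cfc_mulVec_mono (hK (W i ω)) hφ.clip_sub_le x
    rw [← cfc_add_cfc, ← smul_cfc, Matrix.add_mulVec, dotProduct_add, Matrix.smul_mulVec,
      dotProduct_smul, smul_eq_mul] at h
    linarith
  have hb1 := mul_le_mul_of_nonneg_left kb.1 (Nat.cast_nonneg (α := ℝ) n)
  have hb2 := mul_le_mul_of_nonneg_left kb.2 (Nat.cast_nonneg (α := ℝ) n)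
  rw [Matrix.sub_mulVec, dotProduct_sub, Matrix.smul_mulVec, dotProduct_smul, smul_eq_mul]
  exact abs_le.mpr ⟨by linarith, by linarith⟩

end Concentration

/-! ### Tensors and their unfolding -/

section Unfolding

variable {d : ℕ}

/-- Expand in the standard basis. Nonemptiness makes the infimum in `cpRank` an attained one rather
than the default value 0. -/
theorem exists_eq_sum_rankOne (Z : Tensor d) :
    {r : ℕ | ∃ u v s t : Fin r → Fin d → ℝ, Z = ∑ j, rankOne (u j) (v j) (s j) (t j)}.Nonempty := by
  let e := (Fintype.equivFin (Fin d × Fin d × Fin d × Fin d)).symm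
  refine ⟨_, fun j => Pi.single (e j).1 (Z (e j).1 (e j).2.1 (e j).2.2.1 (e j).2.2.2),
    fun j => Pi.single (e j).2.1 1, fun j => Pi.single (e j).2.2.1 1,
    fun j => Pi.single (e j).2.2.2 1, ?_⟩
  rw [e.sum_comp fun j => rankOne (Pi.single j.1 (Z j.1 j.2.1 j.2.2.1 j.2.2.2))
    (Pi.single j.2.1 1) (Pi.single j.2.2.1 1) (Pi.single j.2.2.2 1)]
  funext a b c k
  simp only [Finset.sum_apply, rankOne]
  rw [Finset.sum_eq_single (a, b, c, k)]
  · simp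
  · rintro ⟨a', b', c', k'⟩ - hne
    by_cases ha : a = a'
    · by_cases hb : b = b'
      · by_cases hc : c = c'
        · by_cases hk : k = k'
          · exact absurd (by rw [ha, hb, hc, hk]) hne
          · simp [Pi.single_apply, hk]
        · simp [Pi.single_apply, hc]
      · simp [Pi.single_apply, hb]
    · simp [Pi.single_apply, ha]
  · simp

/-- The unfolding of u ⊗ v ⊗ s ⊗ t is the outer product of u ⊗ v and s ⊗ t, so a decomposition with
r terms factors the unfolding through ℝ^r. -/
theorem rank_smul_mat_le_cpRank (c : ℝ) (Z : Tensor d) : (c • mat Z).rank ≤ cpRank Z := by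
  obtain ⟨u, v, s, t, h⟩ := Nat.sInf_mem (exists_eq_sum_rankOne Z)
  have e : c • mat Z = (Matrix.of fun (k : Fin (d * d)) (j : Fin (cpRank Z)) =>
      c * (u j k.modNat * v j k.divNat)) *
      Matrix.of fun (j : Fin (cpRank Z)) (k : Fin (d * d)) => s j k.modNat * t j k.divNat := by
    ext k l
    have hZ := congrFun (congrFun (congrFun (congrFun h k.modNat) k.divNat) l.modNat) l.divNat
    simp only [Finset.sum_apply, rankOne] at hZ
    simp only [mat, Matrix.smul_apply, Matrix.of_apply, Matrix.mul_apply, smul_eq_mul]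
    rw [hZ, Finset.mul_sum]
    exact Finset.sum_congr rfl fun j _ => by ring
  rw [e]
  exact (Matrix.rank_mul_le_left _ _).trans ((Matrix.rank_le_card_width _).trans
    (Fintype.card_fin _).le)

/-- The tensor index of an entry of the square unfolding. -/
def unfoldIndex (k l : Fin (d * d)) : Fin d × Fin d × Fin d × Fin d :=
  (k.modNat, k.divNat, l.modNat, l.divNat)

theorem divNat_modNat_injective {k l : Fin (d * d)} (h1 : k.modNat = l.modNat)
    (h2 : k.divNat = l.divNat) : k = l :=
  finProdFinEquiv.symm.injective (Prod.ext h2 h1)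

/-- Positions in one row of the unfolding come from distinct tensor entries, so the scores along a
row are independent; the next lemma does the same for columns. -/
theorem unfoldIndex_right_injective (k : Fin (d * d)) : Function.Injective (unfoldIndex k) :=
  fun l l' h => by
    simp only [unfoldIndex, Prod.mk.injEq, true_and] at h
    exact divNat_modNat_injective h.1 h.2

theorem unfoldIndex_left_injective (l : Fin (d * d)) :
    Function.Injective fun k => unfoldIndex k l := fun k k' h => by
  simp only [unfoldIndex, Prod.mk.injEq, and_true] at h
  exact divNat_modNat_injective h.1 h.2

theorem tensorInner_eq_sum (Z V : Tensor d) :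
    tensorInner Z V = ∑ j : Fin d × Fin d × Fin d × Fin d,
      Z j.1 j.2.1 j.2.2.1 j.2.2.2 * V j.1 j.2.1 j.2.2.1 j.2.2.2 := by
  simp only [tensorInner, Fintype.sum_prod_type]

end Unfolding

/-! ### Moments of the response-score products -/

section Model

variable {d : ℕ} {Ω : Type*} [MeasurableSpace Ω] {P : Measure Ω} [IsProbabilityMeasure P]
  {p₀ f : ℝ → ℝ} {β : Tensor d} {X : Ω → Tensor d} {ε Y : Ω → ℝ} {M : ℝ}

theorem measurable_tensor_apply (j : Fin d × Fin d × Fin d × Fin d) :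
    Measurable fun x : Tensor d => x j.1 j.2.1 j.2.2.1 j.2.2.2 :=
  (measurable_pi_apply j.2.2.2).comp ((measurable_pi_apply j.2.2.1).comp
    ((measurable_pi_apply j.2.1).comp (measurable_pi_apply j.1)))

theorem measurable_tensorInner_left (β : Tensor d) :
    Measurable fun x : Tensor d => tensorInner x β := by
  simp only [tensorInner_eq_sum]
  exact Finset.measurable_fun_sum _ fun j _ => (measurable_tensor_apply j).mul_const _

theorem integrable_mul_of_sq {U V : Ω → ℝ} (hU : Measurable U) (hV : Measurable V)
    (hU2 : Integrable (fun ω => U ω ^ 2) P) (hV2 : Integrable (fun ω => V ω ^ 2) P) :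
    Integrable (fun ω => U ω * V ω) P := by
  refine (hU2.add hV2).mono (hU.mul hV).aestronglyMeasurable
    (Filter.Eventually.of_forall fun ω => ?_)
  simp only [Pi.add_apply]
  rw [Real.norm_of_nonneg (by positivity : 0 ≤ U ω ^ 2 + V ω ^ 2), Real.norm_eq_abs, abs_le]
  constructor <;> nlinarith [sq_nonneg (U ω + V ω), sq_nonneg (U ω - V ω)]

/-- The score of an entry of `X`. -/
noncomputable def entryScore (p₀ : ℝ → ℝ) (X : Ω → Tensor d)
    (j : Fin d × Fin d × Fin d × Fin d) (ω : Ω) : ℝ :=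
  score p₀ (X ω j.1 j.2.1 j.2.2.1 j.2.2.2)

theorem Model.measurable_score (h : Model P p₀ f β X ε Y) : Measurable (score p₀) :=
  TensorSIM.measurable_score p₀ h.density.differentiable.continuous.measurable

theorem Model.measurable_entry (h : Model P p₀ f β X ε Y) (j : Fin d × Fin d × Fin d × Fin d) :
    Measurable fun ω => X ω j.1 j.2.1 j.2.2.1 j.2.2.2 :=
  (measurable_tensor_apply j).comp h.measurable_X

theorem Model.measurable_entryScore (h : Model P p₀ f β X ε Y)
    (j : Fin d × Fin d × Fin d × Fin d) : Measurable (entryScore p₀ X j) :=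
  h.measurable_score.comp (h.measurable_entry j)

theorem Model.measurable_signal (h : Model P p₀ f β X ε Y) :
    Measurable fun ω => f (tensorInner (X ω) β) :=
  h.link_differentiable.continuous.measurable.comp
    ((measurable_tensorInner_left β).comp h.measurable_X)

theorem Model.measurable_response (h : Model P p₀ f β X ε Y) : Measurable Y := by
  have : Y = fun ω => f (tensorInner (X ω) β) + ε ω := funext h.response
  rw [this]
  exact h.measurable_signal.add h.measurable_noise

theorem Model.iIndepFun_entryScore (h : Model P p₀ f β X ε Y) : iIndepFun (entryScore p₀ X) P :=
  h.entries_indep.comp (fun _ => score p₀) fun _ => h.measurable_score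

theorem Model.integral_entry (h : Model P p₀ f β X ε Y) (j : Fin d × Fin d × Fin d × Fin d)
    {g : ℝ → ℝ} (hg : Measurable g) :
    ∫ ω, g (X ω j.1 j.2.1 j.2.2.1 j.2.2.2) ∂P = ∫ u, g u ∂densityMeasure p₀ := by
  rw [← h.entries_law j.1 j.2.1 j.2.2.1 j.2.2.2,
    integral_map (h.measurable_entry j).aemeasurable hg.aestronglyMeasurable]

theorem Model.integrable_entryScore_pow (h : Model P p₀ f β X ε Y) (hm : MomentBound P p₀ Y M)
    (j : Fin d × Fin d × Fin d × Fin d) : Integrable (fun ω => entryScore p₀ X j ω ^ 4) P := by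
  have := hm.score_integrable
  rw [← h.entries_law j.1 j.2.1 j.2.2.1 j.2.2.2,
    integrable_map_measure (h.measurable_score.pow_const 4).aestronglyMeasurable
      (h.measurable_entry j).aemeasurable] at this
  exact this

theorem Model.integral_entryScore_pow_le (h : Model P p₀ f β X ε Y) (hm : MomentBound P p₀ Y M)
    (j : Fin d × Fin d × Fin d × Fin d) : ∫ ω, entryScore p₀ X j ω ^ 4 ∂P ≤ M :=
  (h.integral_entry j (h.measurable_score.pow_const 4)).trans_le hm.score_le

theorem Model.integrable_entryScore (h : Model P p₀ f β X ε Y) (hm : MomentBound P p₀ Y M)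
    (j : Fin d × Fin d × Fin d × Fin d) : Integrable (entryScore p₀ X j) P := by
  simpa using integrable_pow_of_pow_four (h.measurable_entryScore j)
    (h.integrable_entryScore_pow hm j) (k := 1) (by norm_num)

/-- Integration by parts against the constant function 1. -/
theorem Model.integral_entryScore (h : Model P p₀ f β X ε Y) (hm : MomentBound P p₀ Y M)
    (j : Fin d × Fin d × Fin d × Fin d) : ∫ ω, entryScore p₀ X j ω ∂P = 0 := by
  have hP : IsProbabilityMeasure (densityMeasure p₀) :=
    h.entries_law j.1 j.2.1 j.2.2.1 j.2.2.2 ▸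
      Measure.isProbabilityMeasure_map (h.measurable_entry j).aemeasurable
  have hs : Integrable (score p₀) (densityMeasure p₀) := by
    rw [← h.entries_law j.1 j.2.1 j.2.2.1 j.2.2.2,
      integrable_map_measure h.measurable_score.aestronglyMeasurable
        (h.measurable_entry j).aemeasurable]
    exact h.integrable_entryScore hm j
  have := integral_mul_score (h := fun _ => 1) h.density (differentiable_const _)
    (integrable_const _) (by simp) (by simpa using hs)
  simp only [one_mul, deriv_const', integral_zero] at this
  exact (h.integral_entry j h.measurable_score).trans this

theorem Model.integrable_signal_sq (h : Model P p₀ f β X ε Y) (hm : MomentBound P p₀ Y M) :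
    Integrable (fun ω => f (tensorInner (X ω) β) ^ 2) P := by
  have hY2 := integrable_pow_of_pow_four h.measurable_response hm.response_integrable (k := 2)
    (by norm_num)
  simp only [h.response] at hY2
  exact integrable_sq_of_indepFun_add h.measurable_signal h.measurable_noise
    (h.noise_indep.symm.comp measurable_id
      (h.link_differentiable.continuous.measurable.comp (measurable_tensorInner_left β))) hY2

/-- The first-order Stein identity for the signal. -/
theorem Model.integral_signal_mul_entryScore (h : Model P p₀ f β X ε Y)
    (hm : MomentBound P p₀ Y M) (j : Fin d × Fin d × Fin d × Fin d) :
    ∫ ω, f (tensorInner (X ω) β) * entryScore p₀ X j ω ∂P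
      = β j.1 j.2.1 j.2.2.1 j.2.2.2 * meanDeriv P X f β := by
  classical
  -- T collects the other entries: ⟨X, β⟩ = β_j X_j + T with T independent of X_j, the setting of
  -- the one-variable Stein identity.
  set T : Ω → ℝ := fun ω => ∑ k ∈ Finset.univ.erase j,
    X ω k.1 k.2.1 k.2.2.1 k.2.2.2 * β k.1 k.2.1 k.2.2.1 k.2.2.2 with hT
  have hinner : ∀ ω, tensorInner (X ω) β
      = β j.1 j.2.1 j.2.2.1 j.2.2.2 * X ω j.1 j.2.1 j.2.2.1 j.2.2.2 + T ω := fun ω => by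
    rw [tensorInner_eq_sum, ← Finset.add_sum_erase _ _ (Finset.mem_univ j), mul_comm]
  have hTm : Measurable T := Finset.measurable_fun_sum _ fun k _ =>
    (h.measurable_entry k).mul_const _
  have hTU : IndepFun T (fun ω => X ω j.1 j.2.1 j.2.2.1 j.2.2.2) P := by
    have hi := h.entries_indep.indepFun_finset (Finset.univ.erase j) {j} (by simp)
      h.measurable_entry
    have hψ : Measurable fun w : ↥({j} : Finset (Fin d × Fin d × Fin d × Fin d)) → ℝ =>
        w ⟨j, Finset.mem_singleton_self j⟩ := measurable_pi_apply _
    have := hi.comp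
      (φ := fun w : ↥(Finset.univ.erase j) → ℝ =>
        ∑ k, w k * β k.1.1 k.1.2.1 k.1.2.2.1 k.1.2.2.2)
      (ψ := fun w : ↥({j} : Finset (Fin d × Fin d × Fin d × Fin d)) → ℝ => w ⟨j, Finset.mem_singleton_self j⟩)
      (Finset.measurable_fun_sum _ fun k _ => (measurable_pi_apply k).mul_const _)
      hψ
    convert this using 1
    · funext ω
      exact (Finset.sum_coe_sort (Finset.univ.erase j) fun k =>
        X ω k.1 k.2.1 k.2.2.1 k.2.2.2 * β k.1 k.2.1 k.2.2.1 k.2.2.2).symm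
    · rfl
  have hF1 : Integrable (fun ω => f (tensorInner (X ω) β)) P := by
    simpa using integrable_mul_of_sq h.measurable_signal (measurable_const (a := (1 : ℝ)))
      (h.integrable_signal_sq hm) (integrable_const _)
  have hF2 := integrable_mul_of_sq h.measurable_signal (h.measurable_entryScore j)
    (h.integrable_signal_sq hm) (integrable_pow_of_pow_four (h.measurable_entryScore j)
      (h.integrable_entryScore_pow hm j) (by norm_num))
  have hF3 := h.deriv_integrable
  rw [meanDeriv]
  simp only [hinner] at hF1 hF2 hF3 ⊢
  exact integral_comp_mul_score h.density h.link_differentiable (h.measurable_entry j) hTm hTU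
    (h.entries_law _ _ _ _) _ hF1 hF3 hF2

theorem Model.integrable_response_mul_entryScore (h : Model P p₀ f β X ε Y)
    (hm : MomentBound P p₀ Y M) (j : Fin d × Fin d × Fin d × Fin d) :
    Integrable (fun ω => Y ω * entryScore p₀ X j ω) P :=
  integrable_mul_of_sq h.measurable_response (h.measurable_entryScore j)
    (integrable_pow_of_pow_four h.measurable_response hm.response_integrable (by norm_num))
    (integrable_pow_of_pow_four (h.measurable_entryScore j) (h.integrable_entryScore_pow hm j)
      (by norm_num))

theorem Model.integrable_response_mul_entryScore_sq (h : Model P p₀ f β X ε Y)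
    (hm : MomentBound P p₀ Y M) (j : Fin d × Fin d × Fin d × Fin d) :
    Integrable (fun ω => (Y ω * entryScore p₀ X j ω) ^ 2) P := by
  simp only [mul_pow]
  refine integrable_mul_of_sq (h.measurable_response.pow_const 2)
    ((h.measurable_entryScore j).pow_const 2) ?_ ?_
  · simpa only [← pow_mul] using hm.response_integrable
  · simpa only [← pow_mul] using h.integrable_entryScore_pow hm j

/-- The noise is centred and independent of the score, so only the signal contributes. -/
theorem Model.integral_response_mul_entryScore (h : Model P p₀ f β X ε Y)
    (hm : MomentBound P p₀ Y M) (j : Fin d × Fin d × Fin d × Fin d) :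
    ∫ ω, Y ω * entryScore p₀ X j ω ∂P = β j.1 j.2.1 j.2.2.1 j.2.2.2 * meanDeriv P X f β := by
  have hind : IndepFun ε (entryScore p₀ X j) P :=
    h.noise_indep.symm.comp measurable_id (h.measurable_score.comp (measurable_tensor_apply j))
  have hεi : Integrable (fun ω => ε ω * entryScore p₀ X j ω) P :=
    hind.integrable_mul h.noise_integrable (h.integrable_entryScore hm j)
  have hε0 : ∫ ω, ε ω * entryScore p₀ X j ω ∂P = 0 := by
    rw [hind.integral_fun_mul_eq_mul_integral h.noise_integrable.aestronglyMeasurable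
      (h.integrable_entryScore hm j).aestronglyMeasurable, h.noise_centered, zero_mul]
  have hFi := integrable_mul_of_sq h.measurable_signal (h.measurable_entryScore j)
    (h.integrable_signal_sq hm) (integrable_pow_of_pow_four (h.measurable_entryScore j)
      (h.integrable_entryScore_pow hm j) (by norm_num))
  simp only [h.response, add_mul]
  rw [integral_add hFi hεi, hε0, add_zero, h.integral_signal_mul_entryScore hm]

theorem Model.integral_sq_response_mul_sum_le (h : Model P p₀ f β X ε Y)
    (hm : MomentBound P p₀ Y M) (hM : 0 < M) {ι : Type*} [Fintype ι]
    {q : ι → Fin d × Fin d × Fin d × Fin d} (hq : Function.Injective q) (u : ι → ℝ) :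
    ∫ ω, (Y ω * ∑ i, u i * entryScore p₀ X (q i) ω) ^ 2 ∂P ≤ 2 * M * ∑ i, u i ^ 2 :=
  integral_sq_mul_linearCombination_le (fun i => h.measurable_entryScore (q i))
    (h.iIndepFun_entryScore.precomp hq) (fun i => h.integrable_entryScore_pow hm (q i))
    (fun i => h.integral_entryScore hm (q i)) hM (fun i => h.integral_entryScore_pow_le hm (q i))
    hm.response_integrable hm.response_le u

/-! ### The dilated response-score matrix -/

/-- The dilation of `κ y Mat(S(x))`. -/
noncomputable def scoreDilation (p₀ : ℝ → ℝ) (κ : ℝ) (e : Tensor d × ℝ) :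
    Matrix (Fin (d * d) ⊕ Fin (d * d)) (Fin (d * d) ⊕ Fin (d * d)) ℝ :=
  dilation ((κ * e.2) • mat (tensorScore p₀ e.1))

theorem scoreDilation_inl_inr (κ : ℝ) (ω : Ω) (k l : Fin (d * d)) :
    scoreDilation p₀ κ (X ω, Y ω) (Sum.inl k) (Sum.inr l)
      = κ * (Y ω * entryScore p₀ X (unfoldIndex k l) ω) := mul_assoc _ _ _

theorem scoreDilation_inr_inl (κ : ℝ) (ω : Ω) (k l : Fin (d * d)) :
    scoreDilation p₀ κ (X ω, Y ω) (Sum.inr l) (Sum.inl k)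
      = κ * (Y ω * entryScore p₀ X (unfoldIndex k l) ω) := mul_assoc _ _ _

theorem measurable_scoreDilation (hs : Measurable (score p₀)) (κ : ℝ)
    (a b : Fin (d * d) ⊕ Fin (d * d)) :
    Measurable fun e : Tensor d × ℝ => scoreDilation p₀ κ e a b := by
  have h : ∀ k l : Fin (d * d), Measurable fun e : Tensor d × ℝ =>
      κ * e.2 * score p₀ (e.1 k.modNat k.divNat l.modNat l.divNat) := fun k l =>
    (measurable_snd.const_mul κ).mul (hs.comp ((measurable_tensor_apply (unfoldIndex k l)).comp
      measurable_fst))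
  rcases a with k | k <;> rcases b with l | l
  · exact measurable_const
  · exact h k l
  · exact h l k
  · exact measurable_const

theorem Model.integrable_scoreDilation (h : Model P p₀ f β X ε Y) (hm : MomentBound P p₀ Y M)
    (κ : ℝ) (a b : Fin (d * d) ⊕ Fin (d * d)) :
    Integrable (fun ω => scoreDilation p₀ κ (X ω, Y ω) a b) P ∧
      Integrable (fun ω => scoreDilation p₀ κ (X ω, Y ω) a b ^ 2) P := by
  rcases a with k | k <;> rcases b with l | l
  · simp [scoreDilation, dilation]
  · simp only [scoreDilation_inl_inr, mul_pow κ]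
    exact ⟨(h.integrable_response_mul_entryScore hm _).const_mul κ,
      (h.integrable_response_mul_entryScore_sq hm _).const_mul _⟩
  · simp only [scoreDilation_inr_inl, mul_pow κ]
    exact ⟨(h.integrable_response_mul_entryScore hm _).const_mul κ,
      (h.integrable_response_mul_entryScore_sq hm _).const_mul _⟩
  · simp [scoreDilation, dilation]

theorem Model.measurable_pair (h : Model P p₀ f β X ε Y) : Measurable fun ω => (X ω, Y ω) :=
  h.measurable_X.prodMk h.measurable_response

theorem Model.integrable_scoreDilation_mul_self (h : Model P p₀ f β X ε Y)
    (hm : MomentBound P p₀ Y M) (κ : ℝ) (a b : Fin (d * d) ⊕ Fin (d * d)) :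
    Integrable (fun ω => (scoreDilation p₀ κ (X ω, Y ω) * scoreDilation p₀ κ (X ω, Y ω)) a b)
      P := by
  simp only [Matrix.mul_apply]
  have hms := fun a b => (measurable_scoreDilation (d := d) h.measurable_score κ a b).comp
    h.measurable_pair
  exact integrable_finsetSum _ fun c _ => integrable_mul_of_sq (hms a c) (hms c b)
    (h.integrable_scoreDilation hm κ a c).2 (h.integrable_scoreDilation hm κ c b).2

theorem Model.meanMatrix_scoreDilation (h : Model P p₀ f β X ε Y) (hm : MomentBound P p₀ Y M)
    (κ : ℝ) : meanMatrix P (fun ω => scoreDilation p₀ κ (X ω, Y ω))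
      = κ • dilation (meanDeriv P X f β • mat β) := by
  ext a b
  rw [meanMatrix, Matrix.of_apply]
  rcases a with k | k <;> rcases b with l | l
  · simp [scoreDilation, dilation]
  · simp only [scoreDilation_inl_inr, integral_const_mul, h.integral_response_mul_entryScore hm]
    simp [dilation, mat, unfoldIndex, mul_comm]
  · simp only [scoreDilation_inr_inl, integral_const_mul, h.integral_response_mul_entryScore hm]
    simp [dilation, mat, unfoldIndex, mul_comm]
  · simp [scoreDilation, dilation]

/-- |Kx|² splits into d² row terms and d² column terms, each the square of κY times a linear
combination of independent scores, hence of mean at most 2Mκ² times the squared norm of the relevant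
half of x. -/
theorem Model.integral_scoreDilation_sq_le (h : Model P p₀ f β X ε Y) (hm : MomentBound P p₀ Y M)
    (hM : 0 < M) (κ : ℝ) (x : Fin (d * d) ⊕ Fin (d * d) → ℝ) :
    ∫ ω, x ⬝ᵥ (scoreDilation p₀ κ (X ω, Y ω) * scoreDilation p₀ κ (X ω, Y ω)) *ᵥ x ∂P
      ≤ κ ^ 2 * (2 * (d : ℝ) ^ 2 * M) * (x ⬝ᵥ x) := by
  have hexp : ∀ ω, x ⬝ᵥ (scoreDilation p₀ κ (X ω, Y ω) * scoreDilation p₀ κ (X ω, Y ω)) *ᵥ x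
      = (∑ k, κ ^ 2 * (Y ω * ∑ l, x (Sum.inr l) * entryScore p₀ X (unfoldIndex k l) ω) ^ 2)
        + ∑ l, κ ^ 2 * (Y ω * ∑ k, x (Sum.inl k) * entryScore p₀ X (unfoldIndex k l) ω) ^ 2 :=
    fun ω => by
      have hT : (scoreDilation p₀ κ (X ω, Y ω))ᵀ = scoreDilation p₀ κ (X ω, Y ω) := by
        rw [← Matrix.conjTranspose_eq_transpose_of_trivial]; exact dilation_isHermitian _
      have hsq := dotProduct_mulVec_self (scoreDilation p₀ κ (X ω, Y ω)) x
      rw [hT] at hsq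
      rw [← hsq, dotProduct, Fintype.sum_sum_type]
      have z1 : ∀ k k', scoreDilation p₀ κ (X ω, Y ω) (Sum.inl k) (Sum.inl k') = 0 :=
        fun _ _ => rfl
      have z2 : ∀ k k', scoreDilation p₀ κ (X ω, Y ω) (Sum.inr k) (Sum.inr k') = 0 :=
        fun _ _ => rfl
      simp only [Matrix.mulVec, dotProduct, Fintype.sum_sum_type, z1, z2, scoreDilation_inl_inr,
        scoreDilation_inr_inl, zero_mul, Finset.sum_const_zero, zero_add, add_zero]
      congr 1
      all_goals
        refine Finset.sum_congr rfl fun k _ => ?_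
        rw [← pow_two, ← mul_pow, Finset.mul_sum, Finset.mul_sum]
        congr 1
        exact Finset.sum_congr rfl fun l _ => by ring
  have hint : ∀ {ι : Type} [Fintype ι] (q : ι → Fin d × Fin d × Fin d × Fin d) (u : ι → ℝ),
      Integrable (fun ω => (Y ω * ∑ i, u i * entryScore p₀ X (q i) ω) ^ 2) P := fun q u => by
    simp only [pow_two, Finset.mul_sum, Finset.sum_mul]
    refine integrable_finsetSum _ fun i _ => integrable_finsetSum _ fun i' _ => ?_
    have := (integrable_mul_of_sq
      (h.measurable_response.mul (h.measurable_entryScore (q i)))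
      (h.measurable_response.mul (h.measurable_entryScore (q i')))
      (h.integrable_response_mul_entryScore_sq hm (q i))
      (h.integrable_response_mul_entryScore_sq hm (q i'))).const_mul (u i * u i')
    refine this.congr (Filter.Eventually.of_forall fun ω => ?_)
    simp only [Pi.mul_apply]
    ring
  simp only [hexp]
  rw [integral_add (integrable_finsetSum _ fun k _ => (hint _ _).const_mul _)
    (integrable_finsetSum _ fun k _ => (hint _ _).const_mul _),
    integral_finsetSum _ fun k _ => (hint _ _).const_mul _,
    integral_finsetSum _ fun k _ => (hint _ _).const_mul _]
  have hb : ∀ (q : Fin (d * d) → Fin (d * d) → Fin d × Fin d × Fin d × Fin d)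
      (u : Fin (d * d) → ℝ), (∀ k, Function.Injective (q k)) →
      ∑ k, ∫ ω, κ ^ 2 * (Y ω * ∑ l, u l * entryScore p₀ X (q k l) ω) ^ 2 ∂P
        ≤ κ ^ 2 * (2 * (d : ℝ) ^ 2 * M) * ∑ l, u l ^ 2 := fun q u hq => by
    refine (Finset.sum_le_card_nsmul _ _ (κ ^ 2 * (2 * M * ∑ l, u l ^ 2)) fun k _ => ?_).trans
      (le_of_eq ?_)
    · rw [integral_const_mul]
      exact mul_le_mul_of_nonneg_left (h.integral_sq_response_mul_sum_le hm hM (hq k) u)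
        (sq_nonneg _)
    · rw [Finset.card_univ, Fintype.card_fin, nsmul_eq_mul]
      push_cast
      ring
  have h1 := hb unfoldIndex (fun l => x (Sum.inr l)) unfoldIndex_right_injective
  have h2 := hb (fun l k => unfoldIndex k l) (fun k => x (Sum.inl k)) unfoldIndex_left_injective
  have hx : x ⬝ᵥ x = (∑ l, x (Sum.inr l) ^ 2) + ∑ k, x (Sum.inl k) ^ 2 := by
    rw [dotProduct, Fintype.sum_sum_type, add_comm]
    simp only [pow_two]
  rw [hx, mul_add]
  exact add_le_add h1 h2

end Model

/-! ### From quadratic forms of dilations to operator norms -/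

section Blocks

variable {m : Type*} [Fintype m]

/-- Test the form with u = t⁻¹ A v. -/
theorem dotProduct_mulVec_self_le_of_bilinear {A : Matrix m m ℝ} {t : ℝ} (ht : 0 < t)
    (h : ∀ u v : m → ℝ, u ⬝ᵥ A *ᵥ v ≤ t * (u ⬝ᵥ u + v ⬝ᵥ v) / 2) (v : m → ℝ) :
    (A *ᵥ v) ⬝ᵥ (A *ᵥ v) ≤ t ^ 2 * (v ⬝ᵥ v) := by
  have h1 := h (t⁻¹ • (A *ᵥ v)) v
  simp only [smul_dotProduct, dotProduct_smul, smul_eq_mul] at h1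
  set q := (A *ᵥ v) ⬝ᵥ (A *ᵥ v)
  have h2 := mul_le_mul_of_nonneg_left h1 (show 0 ≤ 2 * t by positivity)
  have e1 : 2 * t * (t⁻¹ * q) = 2 * q := by field_simp
  have e2 : 2 * t * (t * (t⁻¹ * (t⁻¹ * q) + v ⬝ᵥ v) / 2) = q + t ^ 2 * (v ⬝ᵥ v) := by
    field_simp
  rw [e1, e2] at h2
  linarith

/-- Test with (u, 0) and (0, v). Since φ need not be odd, φ of a dilation may have nonzero diagonal
blocks, so the bound is proved for an arbitrary symmetric H. -/
theorem bilinear_toBlocks₁₂_le {H : Matrix (m ⊕ m) (m ⊕ m) ℝ} (hH : H.IsHermitian) {t : ℝ}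
    (h : ∀ x : m ⊕ m → ℝ, |x ⬝ᵥ H *ᵥ x| ≤ t * (x ⬝ᵥ x)) (u v : m → ℝ) :
    u ⬝ᵥ H.toBlocks₁₂ *ᵥ v ≤ t * (u ⬝ᵥ u + v ⬝ᵥ v) / 2 := by
  have := dotProduct_mulVec_le_of_quadratic hH h (Sum.elim u 0) (Sum.elim 0 v)
  simpa [dotProduct, Matrix.mulVec, Fintype.sum_sum_type, Matrix.toBlocks₁₂] using this

theorem loss_eq {n : ℕ} (T : Fin n → Matrix m m ℝ) (B : Matrix m m ℝ) :
    loss T B = matInner B B - 2 * matInner ((n : ℝ)⁻¹ • ∑ i, T i) B := by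
  have : matInner (∑ i, T i) B = ∑ i, matInner (T i) B := by
    simp only [matInner, Matrix.transpose_sum, Finset.sum_mul, Matrix.trace_sum]
  rw [loss, matInner_smul_left, this]
  ring

end Blocks

/-! ### The tuning parameters -/

theorem kappa_pos {d n : ℕ} {M : ℝ} (hd : 2 ≤ d) (hn : 1 ≤ n) (hM : 0 < M) : 0 < kappa d n M := by
  have hL : 0 < Real.log d := Real.log_pos (by exact_mod_cast hd)
  have : (0 : ℝ) < d := by exact_mod_cast (by omega : 0 < d)
  have : (0 : ℝ) < n := by exact_mod_cast hn
  unfold kappa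
  positivity

theorem lam_pos {C : ℝ} (hC : 0 < C) {d n : ℕ} {M : ℝ} (hd : 2 ≤ d) (hn : 1 ≤ n) (hM : 0 < M) :
    0 < lam C d n M := by
  have hL : 0 < Real.log d := Real.log_pos (by exact_mod_cast hd)
  have : (0 : ℝ) < d := by exact_mod_cast (by omega : 0 < d)
  have : (0 : ℝ) < n := by exact_mod_cast hn
  unfold lam
  positivity

/-- This value is the variance proxy η; it makes (1 + 2η)ⁿ at most d¹⁶. -/
theorem kappa_sq_mul {d n : ℕ} {M : ℝ} (hd : 2 ≤ d) (hn : 1 ≤ n) (hM : 0 < M) :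
    kappa d n M ^ 2 * (2 * (d : ℝ) ^ 2 * M) = 8 * Real.log d / n := by
  have hL : 0 < Real.log d := Real.log_pos (by exact_mod_cast hd)
  have : (0 : ℝ) < d := by exact_mod_cast (by omega : 0 < d)
  have : (0 : ℝ) < n := by exact_mod_cast hn
  rw [kappa, div_pow, mul_pow, Real.sq_sqrt (by positivity), Real.sq_sqrt (by positivity)]
  field_simp
  ring

theorem kappa_mul_lam {C : ℝ} (hC : 0 < C) {d n : ℕ} {M : ℝ} (hd : 2 ≤ d) (hn : 1 ≤ n)
    (hM : 0 < M) : kappa d n M * lam C d n M = 4 * C * Real.log d / n := by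
  have hL : 0 < Real.log d := Real.log_pos (by exact_mod_cast hd)
  have : (0 : ℝ) < d := by exact_mod_cast (by omega : 0 < d)
  have : (0 : ℝ) < n := by exact_mod_cast hn
  have h1 : 0 ≤ kappa d n M * lam C d n M :=
    mul_nonneg (kappa_pos hd hn hM).le (lam_pos hC hd hn hM).le
  refine (pow_left_inj₀ h1 (by positivity) two_ne_zero).mp ?_
  rw [mul_pow, kappa, lam, div_pow, mul_pow, mul_pow, Real.sq_sqrt (by positivity),
    Real.sq_sqrt (by positivity), Real.sq_sqrt (by positivity)]
  field_simp
  ring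

/-- The left side is at most 6 d^(2+16-27) = 6d⁻⁹, and the target 1/(4d⁴) then asks for 24 ≤ d⁵,
true from d = 2 on. With 26 in place of 27 this estimate would fail at d = 2. -/
theorem tail_le {d n : ℕ} (hd : 2 ≤ d) (hn : 1 ≤ n) :
    3 * (((2 * (d * d) : ℕ) : ℝ) * (1 + 2 * (8 * Real.log d / n)) ^ n
      * Real.exp (-(27 * Real.log d))) ≤ 1 / (2 * (d : ℝ) ^ 2) ^ 2 := by
  have hd2 : (2 : ℝ) ≤ d := by exact_mod_cast hd
  have hd0 : (0 : ℝ) < d := by linarith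
  have hn0 : (0 : ℝ) < n := by exact_mod_cast hn
  have hL : 0 < Real.log d := Real.log_pos (by linarith)
  have hexp : ∀ k : ℕ, Real.exp (k * Real.log d) = (d : ℝ) ^ k := fun k => by
    rw [Real.exp_nat_mul, Real.exp_log hd0]
  have h1 : (1 + 2 * (8 * Real.log d / n)) ^ n ≤ (d : ℝ) ^ 16 := by
    have h := pow_le_pow_left₀ (by positivity)
      (Real.add_one_le_exp (2 * (8 * Real.log d / n))) n
    rw [← Real.exp_nat_mul, show (n : ℝ) * (2 * (8 * Real.log d / n)) = ((16 : ℕ) : ℝ) * Real.log d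
      by field_simp; norm_num, hexp, add_comm] at h
    exact h
  have h2 : Real.exp (-(27 * Real.log d)) = ((d : ℝ) ^ 27)⁻¹ := by
    rw [Real.exp_neg, ← hexp 27]
    norm_num
  have h5 : (32 : ℝ) ≤ (d : ℝ) ^ 5 := by
    have := pow_le_pow_left₀ (by norm_num) hd2 5
    norm_num at this
    exact this
  rw [h2]
  calc _ ≤ 3 * (((2 * (d * d) : ℕ) : ℝ) * (d : ℝ) ^ 16 * ((d : ℝ) ^ 27)⁻¹) := by gcongr
    _ ≤ 1 / (2 * (d : ℝ) ^ 2) ^ 2 := by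
      push_cast
      rw [← div_eq_mul_inv, ← mul_div_assoc, div_le_div_iff₀ (by positivity) (by positivity)]
      have h22 : (0 : ℝ) < (d : ℝ) ^ 22 := by positivity
      nlinarith [mul_le_mul_of_nonneg_right h5 h22.le]

/-- Concentration of the averaged dilated estimating matrices. -/
theorem measure_not_scoreDilation_sum_le {Ω : Type*} [MeasurableSpace Ω] {P : Measure Ω}
    [IsProbabilityMeasure P] {d n : ℕ} {M : ℝ} {p₀ f φ : ℝ → ℝ} {β : Tensor d}
    {X : Ω → Tensor d} {ε Y : Ω → ℝ} {Xs : Fin n → Ω → Tensor d} {Ys : Fin n → Ω → ℝ}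
    (hd : 2 ≤ d) (hn : 1 ≤ n) (hM : 0 < M) (h : Model P p₀ f β X ε Y)
    (hm : MomentBound P p₀ Y M) (hs : IsSample P X Y Xs Ys) (hφ : IsInfluenceFunction φ) :
    P {ω | ¬ ∀ x : Fin (d * d) ⊕ Fin (d * d) → ℝ,
      |x ⬝ᵥ ((∑ i, (dilation_isHermitian
          ((kappa d n M * Ys i ω) • mat (tensorScore p₀ (Xs i ω)))).cfc φ)
        - (n : ℝ) • (kappa d n M • dilation (meanDeriv P X f β • mat β))) *ᵥ x|
        ≤ 62 * Real.log d * (x ⬝ᵥ x)}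
      ≤ ENNReal.ofReal (1 / (2 * (d : ℝ) ^ 2) ^ 2) := by
  have hn0 : (0 : ℝ) < n := by exact_mod_cast hn
  have hL : 0 < Real.log d := Real.log_pos (by exact_mod_cast hd)
  have key := measure_not_abs_sum_cfc_sub_le (W := fun i ω => (Xs i ω, Ys i ω))
    (V := fun ω => (X ω, Y ω)) (K := scoreDilation p₀ (kappa d n M))
    (fun i => (hs.measurable_X i).prodMk (hs.measurable_Y i)) hs.indep hs.identDistrib
    h.measurable_pair (fun e => dilation_isHermitian _)
    (measurable_scoreDilation h.measurable_score _)
    (fun a b => (h.integrable_scoreDilation hm _ a b).1)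
    (h.integrable_scoreDilation_mul_self hm _) (η := 8 * Real.log d / n) (by positivity)
    (fun x => by
      rw [← kappa_sq_mul hd hn hM]
      exact h.integral_scoreDilation_sq_le hm hM _ x) hφ (27 * Real.log d)
  rw [h.meanMatrix_scoreDilation hm] at key
  have e : (n : ℝ) * (8 * Real.log d / n) + 2 * (27 * Real.log d) = 62 * Real.log d := by
    field_simp
    norm_num
  rw [e] at key
  refine key.trans (ENNReal.ofReal_le_ofReal ?_)
  rw [Fintype.card_sum, Fintype.card_fin, ← two_mul]
  exact tail_le hd hn

/-- The upper right block of the controlled matrix, divided by nκ, is T - c Mat(β). Its operator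
norm and that of its transpose are therefore at most 62 log d / (nκ) = λ/2, the noise level t of the
deterministic bound. -/
theorem frobNorm_sub_le_of_isEstimate {d n r : ℕ} {M : ℝ} {p₀ φ : ℝ → ℝ} {β : Tensor d}
    {x : Fin n → Tensor d} {y : Fin n → ℝ} {B : Matrix (Fin (d * d)) (Fin (d * d)) ℝ} {c : ℝ}
    (hd : 2 ≤ d) (hn : 1 ≤ n) (hM : 0 < M) (hr : cpRank β = r)
    (hB : IsEstimate p₀ φ (kappa d n M) (lam 31 d n M) x y B)
    (hconc : ∀ z : Fin (d * d) ⊕ Fin (d * d) → ℝ,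
      |z ⬝ᵥ ((∑ i, (dilation_isHermitian
          ((kappa d n M * y i) • mat (tensorScore p₀ (x i)))).cfc φ)
        - (n : ℝ) • (kappa d n M • dilation (c • mat β))) *ᵥ z|
        ≤ 62 * Real.log d * (z ⬝ᵥ z)) :
    frobNorm (B - c • mat β) ≤ 3 * √r * lam 31 d n M := by
  have hn0 : (0 : ℝ) < n := by exact_mod_cast hn
  have hL : 0 < Real.log d := Real.log_pos (by exact_mod_cast hd)
  have hκ := kappa_pos hd hn hM
  have hlam := lam_pos (C := 31) (by norm_num) hd hn hM
  have hκlam := kappa_mul_lam (C := 31) (by norm_num) hd hn hM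
  set κ := kappa d n M with hκdef
  set l := lam 31 d n M with hldef
  set T : Fin n → Matrix (Fin (d * d)) (Fin (d * d)) ℝ :=
    fun i => truncate φ κ (y i) (mat (tensorScore p₀ (x i))) with hT
  set H := (∑ i, (dilation_isHermitian ((κ * y i) • mat (tensorScore p₀ (x i)))).cfc φ)
        - (n : ℝ) • (κ • dilation (c • mat β)) with hHdef
  have hH : H.IsHermitian := by
    refine Matrix.IsHermitian.sub ?_ ?_
    · rw [Matrix.IsHermitian, Matrix.conjTranspose_sum]
      exact Finset.sum_congr rfl fun i _ => (cfc_isHermitian _ φ).eq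
    · rw [smul_smul]
      exact (dilation_isHermitian _).smul (IsSelfAdjoint.all _)
  have hblock : (n : ℝ)⁻¹ • ∑ i, T i - c • mat β = (n * κ)⁻¹ • H.toBlocks₁₂ := by
    ext k j
    have hk : κ ≠ 0 := hκ.ne'
    simp only [hT, hHdef, truncate, psi, dilation, Matrix.toBlocks₁₂, Matrix.sub_apply,
      Matrix.smul_apply, Matrix.sum_apply, Matrix.of_apply, Matrix.fromBlocks_apply₁₂,
      smul_eq_mul, ← Finset.mul_sum]
    field_simp
  have hbil := bilinear_toBlocks₁₂_le hH hconc
  have hθ : 0 < 62 * Real.log d := by positivity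
  have hop := dotProduct_mulVec_self_le_of_bilinear hθ hbil
  have hop' := dotProduct_mulVec_self_le_of_bilinear (A := H.toBlocks₁₂ᵀ) hθ fun u v => by
    rw [Matrix.mulVec_transpose, dotProduct_comm, ← Matrix.dotProduct_mulVec]
    have := hbil v u
    linarith
  -- Here C = 31 is forced: κλ = 4C log d / n, so λ/2 = 62 log d / (nκ) means 2C = 62.
  have ht : (n * κ)⁻¹ * (62 * Real.log d) = l / 2 := by
    rw [inv_mul_eq_div, div_eq_iff (by positivity), show l / 2 * (n * κ) = n / 2 * (κ * l) by ring,
      hκlam]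
    field_simp
    norm_num
  have hscale : ∀ A : Matrix (Fin (d * d)) (Fin (d * d)) ℝ,
      (∀ v, (A *ᵥ v) ⬝ᵥ (A *ᵥ v) ≤ (62 * Real.log d) ^ 2 * (v ⬝ᵥ v)) →
      ∀ v, (((n * κ)⁻¹ • A) *ᵥ v) ⬝ᵥ (((n * κ)⁻¹ • A) *ᵥ v) ≤ (l / 2) ^ 2 * (v ⬝ᵥ v) :=
    fun A hA v => by
      rw [← ht, mul_pow, mul_assoc, Matrix.smul_mulVec, smul_dotProduct, dotProduct_smul,
        smul_eq_mul, smul_eq_mul, ← mul_assoc, ← pow_two]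
      exact mul_le_mul_of_nonneg_left (hA v) (sq_nonneg _)
  have hfin := frobNorm_sub_le_of_penalized (T := (n : ℝ)⁻¹ • ∑ i, T i) (B := c • mat β)
    (Bhat := B) (t := l / 2) (r := r) (by positivity) (hr ▸ rank_smul_mat_le_cpRank c β)
    (by rw [hblock]; exact hscale _ hop)
    (by rw [hblock, Matrix.transpose_smul]; exact hscale _ hop') (by
      have h := hB (Set.mem_univ (c • mat β))
      simp only [Set.mem_ofPred_eq, objective, loss_eq] at h
      rw [mul_div_cancel₀ _ (two_ne_zero' ℝ)]
      exact h)
  rwa [mul_div_cancel₀ _ (two_ne_zero' ℝ)] at hfin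

end TensorSIM

/-! ### The recovery theorem -/

theorem theorem3 :
    ∃ C : ℝ, 0 < C ∧
      ∀ {Ω : Type*} [MeasurableSpace Ω] (P : Measure Ω) [IsProbabilityMeasure P]
        (d n r : ℕ) (M : ℝ) (p₀ f φ : ℝ → ℝ) (β : TensorSIM.Tensor d)
        (X : Ω → TensorSIM.Tensor d) (ε Y : Ω → ℝ)
        (Xs : Fin n → Ω → TensorSIM.Tensor d) (Ys : Fin n → Ω → ℝ)
        (βhat : Ω → Matrix (Fin (d * d)) (Fin (d * d)) ℝ),
        2 ≤ d → 1 ≤ n → 0 < M →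
        TensorSIM.Model P p₀ f β X ε Y →
        TensorSIM.cpRank β = r →
        TensorSIM.MomentBound P p₀ Y M →
        TensorSIM.IsSample P X Y Xs Ys →
        TensorSIM.IsInfluenceFunction φ →
        (∀ ω, TensorSIM.IsEstimate p₀ φ (TensorSIM.kappa d n M) (TensorSIM.lam C d n M)
          (fun i => Xs i ω) (fun i => Ys i ω) (βhat ω)) →
        P {ω | ¬ TensorSIM.frobNorm
              (βhat ω - TensorSIM.meanDeriv P X f β • TensorSIM.mat β)
            ≤ 3 * Real.sqrt r * TensorSIM.lam C d n M}
          ≤ ENNReal.ofReal (1 / (2 * (d : ℝ) ^ 2) ^ 2) := by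
  refine ⟨31, by norm_num, ?_⟩
  intro Ω _ P _ d n r M p₀ f φ β X ε Y Xs Ys βhat hd hn hM hmod hr hmom hsam hφ hest
  -- Failure of the error bound is contained in failure of concentration. Monotonicity of the
  -- measure holds for arbitrary sets, so no measurable selection of the minimizer is needed.
  refine le_trans (measure_mono ?_)
    (TensorSIM.measure_not_scoreDilation_sum_le hd hn hM hmod hmom hsam hφ)
  intro ω hω
  rw [Set.mem_ofPred_eq] at hω ⊢
  exact fun hconc =>
    hω (TensorSIM.frobNorm_sub_le_of_isEstimate hd hn hM hr (hest ω) hconc)
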